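/- A topological space $X$ is a \emph{Gruenhage space} if there are families $\mathscr U_n$ ($n\in\mathbb N$) of open subsets of $X$ such that for all distinct $x,y\in X$ there are $n$ and $U\in\mathscr U_n$ for which $U\cap\{x,y\}$ is a singleton and at least one of $x$, $y$ lies in only finitely many members of $\mathscr U_n$. A norm on a Banach space $X$ is \emph{strictly convex} if $\|x\|=\|y\|=\frac12\|x+y\|$ implies $x=y$. For a subspace $F\subseteq X^*$, it is \emph{p-UR against $F$} if, whenever $\|x_n\|=\|y_n\|=1$ and $\|x_n+y_n\|\to 2$, one has $f(x_n-y_n)\to 0$ for every $f\in F$; it is \emph{p-UR} if it is p-UR against some $F$ that separates the points of $X$. \textbf{Theorem.} Let $K$ be a compact Hausdorff Gruenhage space, and identify the dual $C(K)^*$ of the space of continuous real functions on $K$ with the space of regular signed Borel measures on $K$. Then: (1) $C(K)^*$ admits an equivalent strictly convex norm that is the dual norm of an equivalent norm on $C(K)$ and is a lattice norm ($|\mu|\le|\nu|$ implies $\|\mu\|\le\|\nu\|$). (2) $C(K)^*$ admits an equivalent p-UR norm that is the dual norm of an equivalent norm on $C(K)$. Moreover, the norm can be chosen p-UR against a subspace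 $N\subseteq C(K)^{**}$ of the following kind. There are closed sets $A_n\subseteq K$ and families $\mathscr H_n$ of pairwise disjoint, relatively open subsets of $A_n$ ($n\in\mathbb N$) such that $\mathscr H=\bigcup_n\mathscr H_n$ separates points (for distinct $x,y\in K$ some $H\in\mathscr H$ contains exactly one of them), is closed under finite non-empty intersections, and contains $K\setminus A_n$ and $A_n\setminus\bigcup\mathscr H_n$ for every $n$; $N$ is the norm-closed linear span in $C(K)^{**}$ of the functionals $\mu\mapsto\mu(H)$, $H\in\mathscr H$; and $N$ is 1-norming: $\|\mu\|_1=\sup\{\xi(\mu):\xi\in N,\ \|\xi\|\le 1\}$ for every $\mu\in C(K)^*$, where $\|\cdot\|_1$ is the usual (total variation) norm. -/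

import Mathlib

open MeasureTheory Filter Topology

namespace GruenhageRenorming

/-- A Gruenhage space. -/
def IsGruenhage (X : Type*) [TopologicalSpace X] : Prop :=
  ∃ 𝒰 : ℕ → Set (Set X), (∀ n, ∀ U ∈ 𝒰 n, IsOpen U) ∧
    ∀ x y : X, x ≠ y → ∃ n, ∃ U ∈ 𝒰 n,
      (∃ z, U ∩ {x, y} = {z}) ∧
      ({V | V ∈ 𝒰 n ∧ x ∈ V}.Finite ∨ {V | V ∈ 𝒰 n ∧ y ∈ V}.Finite)

/-- A family of sets separates points if any two distinct points are told apart by some member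
(which may contain either one of the two). -/
def SeparatesPoints {X : Type*} (ℋ : Set (Set X)) : Prop :=
  ∀ x y : X, x ≠ y → ∃ H ∈ ℋ, ∃ z, {x, y} ∩ H = {z}

/-- A legitimate system `(A n, ℋ n)`, with its three standing normalizations: the union of the
families is closed under finite intersections and contains the complement of each `A n` and the
remainder `A n \ ⋃ ℋ n`. -/
structure IsLegitimateSystem {X : Type*} [TopologicalSpace X]
    (A : ℕ → Set X) (ℋ : ℕ → Set (Set X)) : Prop where
  isClosed : ∀ n, IsClosed (A n)
  relOpen : ∀ n, ∀ H ∈ ℋ n, ∃ O, IsOpen O ∧ H = A n ∩ O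
  disjoint : ∀ n, ∀ H ∈ ℋ n, ∀ H' ∈ ℋ n, H ≠ H' → Disjoint H H'
  separates : SeparatesPoints (⋃ n, ℋ n)
  inter_mem : ∀ H ∈ ⋃ n, ℋ n, ∀ H' ∈ ⋃ n, ℋ n, H ∩ H' ∈ ⋃ n, ℋ n
  compl_mem : ∀ n, (A n)ᶜ ∈ ⋃ n, ℋ n
  diff_mem : ∀ n, A n \ ⋃₀ ℋ n ∈ ⋃ n, ℋ n

section Norms

variable {X : Type*} [NormedAddCommGroup X] [NormedSpace ℝ X]

/-- The dual of a normed space, with the operator norm. -/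
abbrev Dual (X : Type*) [NormedAddCommGroup X] [NormedSpace ℝ X] : Type _ :=
  StrongDual ℝ X

/-- `p` is a norm on `X` equivalent to the given one. -/
def IsEquivalentNorm (p : Seminorm ℝ X) : Prop :=
  ∃ c C : ℝ, 0 < c ∧ ∀ x, c * ‖x‖ ≤ p x ∧ p x ≤ C * ‖x‖

/-- `p` is the dual norm of an equivalent norm `q` on the predual `X`. -/
def IsDualNorm (p : Seminorm ℝ (Dual X)) : Prop :=
  ∃ q : Seminorm ℝ X, IsEquivalentNorm q ∧
    ∀ φ : Dual X, IsLUB {r : ℝ | ∃ x, q x ≤ 1 ∧ φ x = r} (p φ)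

/-- Strict convexity (rotundity) of `p`. -/
def IsStrictlyConvexNorm (p : Seminorm ℝ X) : Prop :=
  ∀ x y, p x = p y → p y = (1 / 2) * p (x + y) → x = y

/-- `p` is uniformly rotund pointwise on the subspace `F` of the dual. -/
def IsPURAgainst (p : Seminorm ℝ X) (F : Submodule ℝ (Dual X)) : Prop :=
  ∀ x y : ℕ → X, (∀ n, p (x n) = 1) → (∀ n, p (y n) = 1) →
    Tendsto (fun n => p (x n + y n)) atTop (𝓝 2) →
    ∀ f ∈ F, Tendsto (fun n => f (x n - y n)) atTop (𝓝 0)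

/-- The subspace `F` of the dual separates the points of `X`. -/
def IsSeparatingSubspace (F : Submodule ℝ (Dual X)) : Prop :=
  ∀ x y : X, x ≠ y → ∃ f ∈ F, f x ≠ f y

/-- `p` is pointwise uniformly rotund (p-UR). -/
def IsPUR (p : Seminorm ℝ X) : Prop :=
  ∃ F : Submodule ℝ (Dual X), IsSeparatingSubspace F ∧ IsPURAgainst p F

/-- `F` is 1-norming for `X`. -/
def IsOneNorming (F : Submodule ℝ (Dual X)) : Prop :=
  ∀ x : X, IsLUB {r : ℝ | ∃ f ∈ F, ‖f‖ ≤ 1 ∧ f x = r} ‖x‖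

/-- The norm-closed linear span. -/
def closedSpan (S : Set X) : Submodule ℝ X :=
  (Submodule.span ℝ S).topologicalClosure

end Norms

section CK

variable {K : Type*} [TopologicalSpace K] [CompactSpace K]

/-- The value at `f ≥ 0` of the modulus `|φ|` of `φ` in the dual Banach lattice `C(K)*`; for the
measure `μ` representing `φ` this is the integral of `f` against the variation of `μ`. -/
noncomputable def modulus (φ : Dual C(K, ℝ)) (f : C(K, ℝ)) : ℝ :=
  sSup {r : ℝ | ∃ g : C(K, ℝ), (∀ t, |g t| ≤ f t) ∧ φ g = r}

/-- `p` is a lattice norm: `|φ| ≤ |ψ|` implies `p φ ≤ p ψ`. -/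
def IsLatticeNorm (p : Seminorm ℝ (Dual C(K, ℝ))) : Prop :=
  ∀ φ ψ, (∀ f : C(K, ℝ), (∀ t, 0 ≤ f t) → modulus φ f ≤ modulus ψ f) → p φ ≤ p ψ

variable [MeasurableSpace K] [BorelSpace K]

/-- `φ` is integration against the regular signed Borel measure `μ - ν`, where `μ` and `ν` are
finite regular (positive) measures. -/
def IsRepresentedBy (φ : Dual C(K, ℝ)) (μ ν : Measure K) : Prop :=
  ∀ f : C(K, ℝ), φ f = (∫ t, f t ∂μ) - (∫ t, f t ∂ν)

/-- `ξ ∈ C(K)**` is the indicator function of the Borel set `S`, that is, the functional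
`μ ↦ μ(S)` on regular signed Borel measures. -/
def IsIndicatorFunctional (S : Set K) (ξ : Dual (Dual C(K, ℝ))) : Prop :=
  ∀ (φ : Dual C(K, ℝ)) (μ ν : Measure K), IsFiniteMeasure μ → IsFiniteMeasure ν →
    μ.Regular → ν.Regular → IsRepresentedBy φ μ ν → ξ φ = μ.real S - ν.real S

/-- The closed linear span in `C(K)**` of the indicator functions of members of `ℋ`. -/
noncomputable def indicatorSpan (ℋ : Set (Set K)) :
    Submodule ℝ (Dual (Dual C(K, ℝ))) :=
  closedSpan {ξ | ∃ H ∈ ℋ, IsIndicatorFunctional H ξ}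

end CK

end GruenhageRenorming

/-! Call a closed set `A` with a disjoint family `ℋ` of relatively open subsets a legitimate pair.
The points lying in at most `m` members of an open family form a closed set, and the traces on it of
`m`-fold intersections are disjoint. A Gruenhage structure therefore gives countably many legitimate
pairs whose members separate points (`IsGruenhage.exists_isLegitimateSystem`).

To each pair belongs the gauge `μ(Aᶜ) + ‖(μ(H))_H‖₂` on positive measures. Since `Aᶜ` and all `H ∪
Aᶜ` are open, inner regularity and Urysohn functions show that the gauge of the positive part (or of
the variation) of a functional is the support function of a set of continuous functions
(`supportFn_posSet`, `supportFn_absSet`). An `ℓ²` sum of such support functions at `φ` and `-φ` is a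
supremum of evaluations at elements of `C(K)`, hence a dual norm. Positive parts give the p-UR norm,
variations give the lattice norm.

Rotundity uses the uniform convexity of Hilbert space twice. In the outer `ℓ²` sum it makes every
gauge asymptotically equal and additive on the two sequences (`tendsto_supportFn`). The pairs `(K,
{Aᶜ})` then settle the terms `μ(Aᶜ)`, and uniform convexity of `ℓ²(ℋ)` gives convergence on every
`H` (`tendsto_measureReal_of_pairGauge`).

The span of the indicators is 1-norming: outside a set of small measure all members of the system
are relatively clopen in one compact set, where Stone–Weierstrass applies
(`isOneNorming_indicatorSpan`). For strict convexity, two functionals in the equality case thus have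
the same variation. The pair with `A = ∅` makes the variation norm additive on them, which forces
equal signs (`eq_of_varMeasure_eq`). -/

namespace GruenhageRenorming

/-! ### Uniform convexity of Hilbert space. -/

section Hilbert

theorem real_inner_eq_mul (a b : ℝ) : inner ℝ a b = a * b := by
  simp [mul_comm]

variable {E : Type*} [NormedAddCommGroup E] [InnerProductSpace ℝ E]

/-- Uniform convexity of a Hilbert norm along bounded sequences. -/
theorem tendsto_sub_of_norm_add {a b : ℕ → E} {C : ℝ} (ha : ∀ n, ‖a n‖ ≤ C) (hb : ∀ n, ‖b n‖ ≤ C)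
    (h : Tendsto (fun n => ‖a n‖ - ‖b n‖) atTop (𝓝 0))
    (h' : Tendsto (fun n => ‖a n‖ + ‖b n‖ - ‖a n + b n‖) atTop (𝓝 0)) :
    Tendsto (fun n => a n - b n) atTop (𝓝 0) := by
  have key : ∀ n, ‖a n - b n‖ ^ 2 ≤
      |‖a n‖ - ‖b n‖| * (2 * C) + (‖a n‖ + ‖b n‖ - ‖a n + b n‖) * (4 * C) := by
    intro n
    have hp := parallelogram_law_with_norm ℝ (a n) (b n)
    have h1 := norm_add_le (a n) (b n)
    have h2 := norm_nonneg (a n)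
    have h3 := norm_nonneg (b n)
    have h4 := norm_nonneg (a n + b n)
    -- The parallelogram law, with `2‖a‖² + 2‖b‖²` split as `(‖a‖ - ‖b‖)² + (‖a‖ + ‖b‖)²`.
    have h5 : ‖a n - b n‖ ^ 2 = (‖a n‖ - ‖b n‖) ^ 2 +
        (‖a n‖ + ‖b n‖ - ‖a n + b n‖) * (‖a n‖ + ‖b n‖ + ‖a n + b n‖) := by
      nlinarith [hp]
    have h6 : (‖a n‖ - ‖b n‖) ^ 2 ≤ |‖a n‖ - ‖b n‖| * (2 * C) := by
      rw [← sq_abs, sq]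
      refine mul_le_mul_of_nonneg_left ?_ (abs_nonneg _)
      rw [abs_le]; constructor <;> linarith [ha n, hb n]
    have h7 : (‖a n‖ + ‖b n‖ - ‖a n + b n‖) * (‖a n‖ + ‖b n‖ + ‖a n + b n‖) ≤
        (‖a n‖ + ‖b n‖ - ‖a n + b n‖) * (4 * C) := by
      refine mul_le_mul_of_nonneg_left ?_ (by linarith)
      linarith [ha n, hb n]
    linarith
  have hz : Tendsto (fun n => |‖a n‖ - ‖b n‖| * (2 * C) +
      (‖a n‖ + ‖b n‖ - ‖a n + b n‖) * (4 * C)) atTop (𝓝 0) := by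
    simpa using (h.abs.mul_const (2 * C)).add (h'.mul_const (4 * C))
  have hsq : Tendsto (fun n => ‖a n - b n‖ ^ 2) atTop (𝓝 0) :=
    squeeze_zero (fun n => sq_nonneg _) key hz
  rw [tendsto_zero_iff_norm_tendsto_zero]
  simpa using hsq.sqrt

end Hilbert

/-! ### Dual norms as `ℓ²` sums of support functions. -/

section SupportFunction

variable {X : Type*} [NormedAddCommGroup X] [NormedSpace ℝ X]

/-- The support function of a subset of `X`, as a function on the dual of `X`. -/
noncomputable def supportFn (B : Set X) (φ : Dual X) : ℝ := sSup (Set.image φ B)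

/-- A subset of the unit ball that contains the origin. -/
structure IsUnitSubset (B : Set X) : Prop where
  zero_mem : (0 : X) ∈ B
  norm_le : ∀ x ∈ B, ‖x‖ ≤ 1

namespace IsUnitSubset

variable {B : Set X} (hB : IsUnitSubset B)
include hB

theorem apply_le_norm (φ : Dual X) {x : X} (hx : x ∈ B) : φ x ≤ ‖φ‖ :=
  (le_abs_self _).trans ((φ.le_opNorm x).trans
    (mul_le_of_le_one_right (norm_nonneg _) (hB.norm_le x hx)))

theorem le_supportFn (φ : Dual X) {x : X} (hx : x ∈ B) : φ x ≤ supportFn B φ := by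
  refine le_csSup ⟨‖φ‖, ?_⟩ ⟨x, hx, rfl⟩
  rintro _ ⟨y, hy, rfl⟩
  exact hB.apply_le_norm φ hy

theorem supportFn_le {φ : Dual X} {r : ℝ} (h : ∀ x ∈ B, φ x ≤ r) : supportFn B φ ≤ r := by
  refine csSup_le ⟨_, 0, hB.zero_mem, rfl⟩ ?_
  rintro _ ⟨y, hy, rfl⟩
  exact h y hy

theorem supportFn_nonneg (φ : Dual X) : 0 ≤ supportFn B φ := by
  simpa using hB.le_supportFn φ hB.zero_mem

theorem supportFn_le_norm (φ : Dual X) : supportFn B φ ≤ ‖φ‖ :=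
  hB.supportFn_le fun _ hx => hB.apply_le_norm φ hx

theorem supportFn_add_le (φ ψ : Dual X) :
    supportFn B (φ + ψ) ≤ supportFn B φ + supportFn B ψ :=
  hB.supportFn_le fun _ hx => add_le_add (hB.le_supportFn φ hx) (hB.le_supportFn ψ hx)

theorem exists_lt_apply {φ : Dual X} {r : ℝ} (h : r < supportFn B φ) : ∃ x ∈ B, r < φ x := by
  obtain ⟨_, ⟨x, hx, rfl⟩, h⟩ := exists_lt_of_lt_csSup
    (⟨φ 0, 0, hB.zero_mem, rfl⟩ : (Set.image φ B).Nonempty) h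
  exact ⟨x, hx, h⟩

theorem supportFn_smul {a : ℝ} (ha : 0 ≤ a) (φ : Dual X) :
    supportFn B (a • φ) = a * supportFn B φ := by
  rcases ha.eq_or_lt with rfl | ha
  · refine le_antisymm (hB.supportFn_le fun x _ => by simp) ?_
    rw [zero_mul]; exact hB.supportFn_nonneg _
  · refine le_antisymm (hB.supportFn_le fun x hx => ?_) ?_
    · exact mul_le_mul_of_nonneg_left (hB.le_supportFn φ hx) ha.le
    · rw [mul_comm, ← le_div_iff₀ ha]
      refine hB.supportFn_le fun x hx => ?_
      rw [le_div_iff₀ ha, mul_comm]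
      exact hB.le_supportFn (a • φ) hx

end IsUnitSubset

/-- The sequence of values at `φ` and `-φ` of the support functions of the sets `B n`, with
weights `2⁻ⁿ`. -/
noncomputable def supportCoord (B : ℕ → Set X) (φ : Dual X) (i : ℕ × Bool) : ℝ :=
  (1 / 2) ^ i.1 * supportFn (B i.1) (bif i.2 then φ else -φ)

variable {B : ℕ → Set X} (hB : ∀ n, IsUnitSubset (B n))

theorem memℓp_weight : Memℓp (fun i : ℕ × Bool => ((1 : ℝ) / 2) ^ i.1) 2 := by
  refine Memℓp.of_exponent_ge (q := 1) (memℓp_gen ?_) (by norm_num)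
  have h : Summable fun i : ℕ × Bool => ((1 : ℝ) / 2) ^ i.1 := by
    rw [summable_prod_of_nonneg (fun i => by positivity)]
    refine ⟨fun n => Summable.of_finite, ?_⟩
    simpa using summable_geometric_two.mul_left 2
  convert h using 2 with i
  simp

include hB

theorem supportCoord_nonneg (φ : Dual X) (i : ℕ × Bool) : 0 ≤ supportCoord B φ i :=
  mul_nonneg (by positivity) ((hB _).supportFn_nonneg _)

theorem supportCoord_le (φ : Dual X) (i : ℕ × Bool) :
    supportCoord B φ i ≤ ‖φ‖ * (1 / 2) ^ i.1 := by
  rw [supportCoord, mul_comm]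
  refine mul_le_mul_of_nonneg_right (((hB _).supportFn_le_norm _).trans ?_) (by positivity)
  cases i.2 <;> simp

theorem memℓp_supportCoord (φ : Dual X) : Memℓp (supportCoord B φ) 2 := by
  refine Memℓp.mono (memℓp_weight.const_mul ‖φ‖) fun i => ?_
  rw [Real.norm_of_nonneg (supportCoord_nonneg hB φ i)]
  exact supportCoord_le hB φ i

/-- The vector of weighted support functions in `ℓ²`. -/
noncomputable def supportVec (φ : Dual X) : lp (fun _ : ℕ × Bool => ℝ) 2 :=
  ⟨supportCoord B φ, memℓp_supportCoord hB φ⟩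

theorem supportVec_apply (φ : Dual X) (i : ℕ × Bool) :
    supportVec hB φ i = supportCoord B φ i := rfl

theorem supportCoord_add_le (φ ψ : Dual X) (i : ℕ × Bool) :
    supportCoord B (φ + ψ) i ≤ supportCoord B φ i + supportCoord B ψ i := by
  rw [supportCoord, supportCoord, supportCoord, ← mul_add]
  refine mul_le_mul_of_nonneg_left ?_ (by positivity)
  rcases i with ⟨n, _ | _⟩
  · simp only [cond_false, neg_add]; exact (hB n).supportFn_add_le _ _
  · exact (hB n).supportFn_add_le _ _

/-- The coordinates are nonnegative and sublinear, so the coordinatewise inequality passes to the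
`ℓ²` norm. -/
theorem norm_supportVec_add_le (φ ψ : Dual X) :
    ‖supportVec hB (φ + ψ)‖ ≤ ‖supportVec hB φ + supportVec hB ψ‖ := by
  refine lp.norm_mono (by norm_num) fun i => ?_
  rw [lp.coeFn_add, Pi.add_apply, supportVec_apply, supportVec_apply, supportVec_apply,
    Real.norm_of_nonneg (supportCoord_nonneg hB _ i),
    Real.norm_of_nonneg (add_nonneg (supportCoord_nonneg hB _ i) (supportCoord_nonneg hB _ i))]
  exact supportCoord_add_le hB φ ψ i

/-- Passing to `-φ` only swaps the two Boolean halves of the index set. -/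
theorem norm_supportVec_neg (φ : Dual X) : ‖supportVec hB (-φ)‖ = ‖supportVec hB φ‖ := by
  rw [lp.norm_eq_tsum_rpow (by norm_num), lp.norm_eq_tsum_rpow (by norm_num),
    ← (Equiv.prodCongr (Equiv.refl ℕ) Equiv.boolNot).tsum_eq]
  congr 2
  ext ⟨n, _ | _⟩ <;> simp [supportVec_apply, supportCoord]

theorem supportVec_smul {a : ℝ} (ha : 0 ≤ a) (φ : Dual X) :
    supportVec hB (a • φ) = a • supportVec hB φ := by
  have hneg : -(a • φ) = a • -φ := by ext; simp
  ext ⟨n, _ | _⟩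
  · simp only [lp.coeFn_smul, Pi.smul_apply, supportVec_apply, supportCoord, smul_eq_mul,
      cond_false, hneg, (hB n).supportFn_smul ha]
    ring
  · simp only [lp.coeFn_smul, Pi.smul_apply, supportVec_apply, supportCoord, smul_eq_mul,
      cond_true, (hB n).supportFn_smul ha]
    ring

/-- The seminorm on the dual generated by the sets `B n`: the `ℓ²`-norm of the vector of weighted
support functions. -/
noncomputable def supportNorm : Seminorm ℝ (Dual X) :=
  Seminorm.of (fun φ => ‖supportVec hB φ‖)
    (fun φ ψ => (norm_supportVec_add_le hB φ ψ).trans (norm_add_le _ _))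
    (fun a φ => by
      have h : ∀ a : ℝ, 0 ≤ a → ‖supportVec hB (a • φ)‖ = ‖a‖ * ‖supportVec hB φ‖ := fun a ha => by
        rw [supportVec_smul hB ha, norm_smul]
      rcases le_total 0 a with ha | ha
      · exact h a ha
      · have := h (-a) (by linarith)
        have hneg : (-a) • φ = -(a • φ) := by ext; simp
        rwa [hneg, norm_supportVec_neg, norm_neg] at this)

theorem supportNorm_apply (φ : Dual X) : supportNorm hB φ = ‖supportVec hB φ‖ := rfl

theorem supportNorm_mono {φ ψ : Dual X} (h : ∀ n, supportFn (B n) φ ≤ supportFn (B n) ψ)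
    (h' : ∀ n, supportFn (B n) (-φ) ≤ supportFn (B n) (-ψ)) :
    supportNorm hB φ ≤ supportNorm hB ψ := by
  refine lp.norm_mono (by norm_num) fun i => ?_
  rw [supportVec_apply, supportVec_apply, Real.norm_of_nonneg (supportCoord_nonneg hB _ i),
    Real.norm_of_nonneg (supportCoord_nonneg hB _ i)]
  refine mul_le_mul_of_nonneg_left ?_ (by positivity)
  rcases i with ⟨n, _ | _⟩
  · exact h' n
  · exact h n

/-- A single index bounds the norm from below; in the application it is the pair with `A = ∅`. -/
theorem isEquivalentNorm_supportNorm {n₀ : ℕ}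
    (h₀ : ∀ φ, ‖φ‖ ≤ supportFn (B n₀) φ + supportFn (B n₀) (-φ)) :
    IsEquivalentNorm (supportNorm hB) := by
  refine ⟨(1 / 2) ^ n₀ / 2, ‖(⟨_, memℓp_weight⟩ : lp (fun _ : ℕ × Bool => ℝ) 2)‖,
    by positivity, fun φ => ⟨?_, ?_⟩⟩
  · have h1 := lp.norm_apply_le_norm (by norm_num) (supportVec hB φ) (n₀, true)
    have h2 := lp.norm_apply_le_norm (by norm_num) (supportVec hB φ) (n₀, false)
    rw [supportVec_apply, Real.norm_of_nonneg (supportCoord_nonneg hB _ _)] at h1 h2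
    simp only [supportCoord, cond_true, cond_false] at h1 h2
    have h3 := mul_le_mul_of_nonneg_left (h₀ φ) (by positivity : (0 : ℝ) ≤ (1 / 2) ^ n₀)
    rw [supportNorm_apply]
    linarith
  · rw [supportNorm_apply, mul_comm]
    calc ‖supportVec hB φ‖
        ≤ ‖‖φ‖ • (⟨_, memℓp_weight⟩ : lp (fun _ : ℕ × Bool => ℝ) 2)‖ := by
          refine lp.norm_mono (by norm_num) fun i => ?_
          rw [supportVec_apply, Real.norm_of_nonneg (supportCoord_nonneg hB _ _)]
          refine (supportCoord_le hB φ i).trans (le_abs_self _)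
      _ = _ := by rw [norm_smul, norm_norm]

/-- Every support norm is the supremum of the evaluations that it dominates. -/
theorem exists_lt_apply_of_lt_supportNorm {φ : Dual X} {r : ℝ} (hr : r < supportNorm hB φ) :
    ∃ x : X, r < φ x ∧ ∀ ψ, ψ x ≤ supportNorm hB ψ := by
  rcases lt_or_ge r 0 with hr0 | hr0
  · exact ⟨0, by simpa using hr0, fun ψ => by simp⟩
  rw [supportNorm_apply] at hr
  set v := supportVec hB φ with hv
  have hv0 : 0 < ‖v‖ := hr0.trans_lt hr
  -- The unit vector `u` norms `v` and has nonnegative coordinates. Cutting it off to a finite set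
  -- `F` and replacing each support function by a near-maximizer in `B i.1` produces `x`. The
  -- nonnegativity keeps `ψ x` below `⟪u, supportVec hB ψ⟫` for every `ψ`.
  set u := ‖v‖⁻¹ • v with hu
  have hu1 : ‖u‖ = 1 := by rw [hu, norm_smul, norm_inv, norm_norm, inv_mul_cancel₀ hv0.ne']
  have hu0 : ∀ i, 0 ≤ u i := fun i => by
    rw [hu, lp.coeFn_smul, Pi.smul_apply, smul_eq_mul]
    exact mul_nonneg (by positivity) (supportCoord_nonneg hB φ i)
  have huv : inner ℝ u v = ‖v‖ := by
    rw [hu, real_inner_smul_left, real_inner_self_eq_norm_sq, sq, inv_mul_cancel_left₀ hv0.ne']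
  have hsum := lp.hasSum_inner (𝕜 := ℝ) u v
  rw [huv] at hsum
  obtain ⟨F, hF⟩ := (hsum.eventually (lt_mem_nhds hr)).exists
  set δ := ∑ i ∈ F, inner ℝ (u i) (v i) - r with hδ
  have hδ0 : 0 < δ := by linarith
  set W := ∑ i ∈ F, u i * (1 / 2) ^ i.1 with hW
  have hW0 : 0 ≤ W := Finset.sum_nonneg fun i _ => mul_nonneg (hu0 i) (by positivity)
  set ε := δ / (2 * (W + 1)) with hε
  have hε0 : 0 < ε := by positivity
  have hεW : ε * W < δ := by
    rw [hε, div_mul_eq_mul_div, div_lt_iff₀ (by positivity)]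
    nlinarith
  have hb : ∀ i : ℕ × Bool, ∃ x ∈ B i.1,
      supportFn (B i.1) (bif i.2 then φ else -φ) - ε < (bif i.2 then φ else -φ) x := fun i =>
    (hB i.1).exists_lt_apply (by linarith)
  choose b hbB hbl using hb
  let x : X := ∑ i ∈ F, (u i * (1 / 2) ^ i.1) • (bif i.2 then b i else -b i)
  have hx : ∀ ψ : Dual X, ψ x = ∑ i ∈ F, u i * (1 / 2) ^ i.1 * (bif i.2 then ψ else -ψ) (b i) := by
    intro ψ
    rw [map_sum]
    refine Finset.sum_congr rfl fun i _ => ?_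
    rw [map_smul, smul_eq_mul]
    rcases i with ⟨n, _ | _⟩ <;> simp
  refine ⟨x, ?_, fun ψ => ?_⟩
  · rw [hx]
    calc r = ∑ i ∈ F, inner ℝ (u i) (v i) - δ := by rw [hδ]; ring
      _ < ∑ i ∈ F, inner ℝ (u i) (v i) - ε * W := by linarith
      _ = ∑ i ∈ F, u i * (1 / 2) ^ i.1 *
            (supportFn (B i.1) (bif i.2 then φ else -φ) - ε) := by
          rw [hW, Finset.mul_sum, ← Finset.sum_sub_distrib]
          refine Finset.sum_congr rfl fun i _ => ?_
          rw [hv, supportVec_apply, supportCoord, real_inner_eq_mul]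
          ring
      _ ≤ _ := Finset.sum_le_sum fun i _ =>
          mul_le_mul_of_nonneg_left (hbl i).le (mul_nonneg (hu0 i) (by positivity))
  · rw [hx]
    calc ∑ i ∈ F, u i * (1 / 2) ^ i.1 * (bif i.2 then ψ else -ψ) (b i)
        ≤ ∑ i ∈ F, inner ℝ (u i) (supportVec hB ψ i) := by
          refine Finset.sum_le_sum fun i _ => ?_
          rw [supportVec_apply, supportCoord, real_inner_eq_mul, mul_assoc]
          refine mul_le_mul_of_nonneg_left ?_ (hu0 i)
          exact mul_le_mul_of_nonneg_left ((hB i.1).le_supportFn _ (hbB i)) (by positivity)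
      _ ≤ inner ℝ u (supportVec hB ψ) :=
          sum_le_hasSum _ (fun i _ => by
            rw [real_inner_eq_mul]
            exact mul_nonneg (hu0 i) (supportCoord_nonneg hB ψ i)) (lp.hasSum_inner (𝕜 := ℝ) _ _)
      _ ≤ ‖u‖ * ‖supportVec hB ψ‖ := real_inner_le_norm _ _
      _ = supportNorm hB ψ := by rw [hu1, one_mul, supportNorm_apply]

omit hB in
/-- An equivalent norm on the dual that is a supremum of evaluations is a dual norm. -/
theorem isDualNorm_of_exists_lt_apply {p : Seminorm ℝ (Dual X)} (hp : IsEquivalentNorm p)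
    (h : ∀ φ r, r < p φ → ∃ x : X, r < φ x ∧ ∀ ψ, ψ x ≤ p ψ) : IsDualNorm p := by
  obtain ⟨c, C, hc, hcC⟩ := hp
  have hbdd : ∀ x : X, ∀ ψ : {ψ : Dual X // p ψ ≤ 1}, |ψ.1 x| ≤ c⁻¹ * ‖x‖ := by
    intro x ψ
    have h1 : ‖ψ.1‖ ≤ c⁻¹ := by
      rw [← one_div, le_div_iff₀ hc, mul_comm]
      exact (hcC _).1.trans ψ.2
    exact (ψ.1.le_opNorm x).trans (mul_le_mul_of_nonneg_right h1 (norm_nonneg _))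
  have hB : ∀ x : X, BddAbove (Set.range fun ψ : {ψ : Dual X // p ψ ≤ 1} => |ψ.1 x|) := fun x =>
    ⟨c⁻¹ * ‖x‖, by rintro _ ⟨ψ, rfl⟩; exact hbdd x ψ⟩
  have : Nonempty {ψ : Dual X // p ψ ≤ 1} := ⟨⟨0, by simp⟩⟩
  -- The predual norm is the polar one. An `x` with `ψ x ≤ p ψ` for all `ψ` satisfies `q x ≤ 1`, so
  -- the hypothesis `h` does the work of the bipolar theorem.
  let q : Seminorm ℝ X := Seminorm.of (fun x => ⨆ ψ : {ψ : Dual X // p ψ ≤ 1}, |ψ.1 x|)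
    (fun x y => ciSup_le fun ψ => by
      rw [map_add]
      exact (abs_add_le _ _).trans (add_le_add (le_ciSup (hB x) ψ) (le_ciSup (hB y) ψ)))
    (fun a x => by
      simp only [map_smul, smul_eq_mul, abs_mul, Real.norm_eq_abs]
      exact (Real.mul_iSup_of_nonneg (abs_nonneg a) _).symm)
  have hq : ∀ x, ∀ ψ : Dual X, p ψ ≤ 1 → |ψ x| ≤ q x := fun x ψ hψ => le_ciSup (hB x) ⟨ψ, hψ⟩
  refine ⟨q, ?_, fun φ => ⟨?_, fun r hr => ?_⟩⟩
  · refine ⟨(|C| + 1)⁻¹, c⁻¹, by positivity, fun x => ⟨?_, ciSup_le (hbdd x)⟩⟩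
    obtain ⟨g, hg1, hgx⟩ := exists_dual_vector'' ℝ x
    have hC : (0 : ℝ) < |C| + 1 := by positivity
    have hpg : p ((|C| + 1)⁻¹ • g) ≤ 1 := by
      rw [map_smul_eq_mul, Real.norm_of_nonneg (by positivity), inv_mul_le_iff₀ hC, mul_one]
      calc p g ≤ C * ‖g‖ := (hcC g).2
        _ ≤ |C| * 1 := mul_le_mul (le_abs_self C) hg1 (norm_nonneg _) (abs_nonneg _)
        _ ≤ |C| + 1 := by linarith
    have := hq x _ hpg
    rwa [smul_apply, hgx, smul_eq_mul, abs_of_nonneg (by simp; positivity)]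
      at this
  · rintro _ ⟨x, hx, rfl⟩
    have hε : ∀ ε : ℝ, 0 < ε → φ x ≤ p φ + ε := by
      intro ε hε
      have hpos : 0 < p φ + ε := by positivity
      have h1 : p ((p φ + ε)⁻¹ • φ) ≤ 1 := by
        rw [map_smul_eq_mul, Real.norm_of_nonneg (by positivity), inv_mul_le_iff₀ hpos]
        linarith
      have h2 := (le_abs_self _).trans ((hq x _ h1).trans hx)
      rw [smul_apply, smul_eq_mul, inv_mul_le_iff₀ hpos] at h2
      linarith
    exact le_of_forall_pos_le_add hε
  · by_contra hlt
    obtain ⟨x, hx, hxp⟩ := h φ r (not_le.mp hlt)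
    refine absurd (hr ⟨x, ciSup_le fun ψ => abs_le.mpr ⟨?_, (hxp _).trans ψ.2⟩, rfl⟩)
      (not_le.mpr hx)
    have := (hxp (-ψ.1)).trans ((map_neg_eq_map p ψ.1).le.trans ψ.2)
    rw [neg_apply] at this
    linarith

theorem isDualNorm_supportNorm (h : IsEquivalentNorm (supportNorm hB)) :
    IsDualNorm (supportNorm hB) :=
  isDualNorm_of_exists_lt_apply h fun _ _ => exists_lt_apply_of_lt_supportNorm hB

/-- If two sequences have constant norm `r` and their sums have norm tending to `2 r`, then each
support function asymptotically agrees on them and is asymptotically additive. -/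
theorem tendsto_supportFn {x y : ℕ → Dual X} {r : ℝ} (hx : ∀ k, supportNorm hB (x k) = r)
    (hy : ∀ k, supportNorm hB (y k) = r)
    (hxy : Tendsto (fun k => supportNorm hB (x k + y k)) atTop (𝓝 (2 * r))) (n : ℕ) :
    Tendsto (fun k => supportFn (B n) (x k) - supportFn (B n) (y k)) atTop (𝓝 0) ∧
    Tendsto (fun k => supportFn (B n) (x k) + supportFn (B n) (y k) - supportFn (B n) (x k + y k))
      atTop (𝓝 0) := by
  set a := fun k => supportVec hB (x k)
  set b := fun k => supportVec hB (y k)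
  set s := fun k => supportVec hB (x k + y k)
  have ha : ∀ k, ‖a k‖ = r := hx
  have hb : ∀ k, ‖b k‖ = r := hy
  have hs : Tendsto (fun k => ‖s k‖) atTop (𝓝 (2 * r)) := hxy
  have hle : ∀ k, ‖s k‖ ≤ ‖a k + b k‖ := fun k => norm_supportVec_add_le hB _ _
  have hle' : ∀ k, ‖a k + b k‖ ≤ 2 * r := fun k => (norm_add_le _ _).trans (by rw [ha, hb]; linarith)
  have hab : Tendsto (fun k => ‖a k + b k‖) atTop (𝓝 (2 * r)) :=
    tendsto_of_tendsto_of_tendsto_of_le_of_le hs tendsto_const_nhds hle hle'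
  have h1 : Tendsto (fun k => a k - b k) atTop (𝓝 0) := by
    refine tendsto_sub_of_norm_add (C := r) (fun k => (ha k).le) (fun k => (hb k).le) ?_ ?_
    · simp [ha, hb]
    · simp only [ha, hb]
      have := hab.const_sub (2 * r)
      rw [sub_self] at this
      refine this.congr fun k => by ring
  have h2 : Tendsto (fun k => a k + b k - s k) atTop (𝓝 0) := by
    -- Coordinatewise `0 ≤ s ≤ a + b`, so `a + b - s` and `s` have nonnegative inner product.
    have key : ∀ k, ‖a k + b k - s k‖ ^ 2 ≤ ‖a k + b k‖ ^ 2 - ‖s k‖ ^ 2 := by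
      intro k
      have hin : 0 ≤ inner ℝ (a k + b k - s k) (s k) := by
        rw [lp.inner_eq_tsum]
        refine tsum_nonneg fun i => ?_
        rw [real_inner_eq_mul, lp.coeFn_sub, Pi.sub_apply, lp.coeFn_add, Pi.add_apply]
        exact mul_nonneg (sub_nonneg.mpr (supportCoord_add_le hB _ _ i))
          (supportCoord_nonneg hB _ i)
      have := norm_add_sq_real (a k + b k - s k) (s k)
      rw [sub_add_cancel] at this
      linarith
    have hz : Tendsto (fun k => ‖a k + b k‖ ^ 2 - ‖s k‖ ^ 2) atTop (𝓝 0) := by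
      simpa using (hab.pow 2).sub (hs.pow 2)
    have := (squeeze_zero (fun k => sq_nonneg _) key hz).sqrt
    rw [tendsto_zero_iff_norm_tendsto_zero]
    simpa using this
  have hev : ∀ v : ℕ → lp (fun _ : ℕ × Bool => ℝ) 2, Tendsto v atTop (𝓝 0) →
      Tendsto (fun k => 2 ^ n * v k (n, true)) atTop (𝓝 0) := by
    intro v hv
    have h0 : Tendsto (fun k => v k (n, true)) atTop (𝓝 0) := by
      refine squeeze_zero_norm (fun k => ?_) (tendsto_zero_iff_norm_tendsto_zero.mp hv)
      exact lp.norm_apply_le_norm (by norm_num) _ _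
    simpa using h0.const_mul (2 ^ n)
  have hw : ∀ t : ℝ, (2 : ℝ) ^ n * ((1 / 2) ^ n * t) = t := fun t => by
    rw [← mul_assoc, ← mul_pow]; norm_num
  refine ⟨(hev _ h1).congr fun k => ?_, (hev _ h2).congr fun k => ?_⟩
  · simp only [lp.coeFn_sub, Pi.sub_apply, a, b, supportVec_apply, supportCoord, cond_true,
      mul_sub, hw]
  · simp only [lp.coeFn_sub, lp.coeFn_add, Pi.sub_apply, Pi.add_apply, a, b, s, supportVec_apply,
      supportCoord, cond_true, mul_sub, mul_add, hw]

end SupportFunction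

open scoped NNReal

/-! ### Positive parts and variations through Riesz representation. -/

section PositivePart

variable {K : Type*} [TopologicalSpace K] [CompactSpace K]

/-- The value at `f ≥ 0` of the positive part of the functional `φ`. -/
noncomputable def posFn (φ : Dual C(K, ℝ)) (f : C(K, ℝ)) : ℝ := supportFn (Set.Icc 0 f) φ

theorem norm_le_of_forall_abs_le {f g : C(K, ℝ)} (h : ∀ t, |g t| ≤ f t) : ‖g‖ ≤ ‖f‖ := by
  refine (ContinuousMap.norm_le _ (norm_nonneg _)).mpr fun t => ?_
  exact (h t).trans ((le_abs_self _).trans (f.norm_coe_le_norm t))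

theorem apply_le_norm_mul {φ : Dual C(K, ℝ)} {f g : C(K, ℝ)} (h : ∀ t, |g t| ≤ f t) :
    φ g ≤ ‖φ‖ * ‖f‖ :=
  (le_abs_self _).trans ((φ.le_opNorm g).trans
    (mul_le_mul_of_nonneg_left (norm_le_of_forall_abs_le h) (norm_nonneg _)))

omit [CompactSpace K] in
theorem abs_apply_le_of_mem_Icc {f g : C(K, ℝ)} (hg : g ∈ Set.Icc 0 f) (t : K) : |g t| ≤ f t := by
  rw [abs_of_nonneg (show 0 ≤ g t from hg.1 t)]; exact hg.2 t

theorem le_posFn (φ : Dual C(K, ℝ)) {f g : C(K, ℝ)} (hg : g ∈ Set.Icc 0 f) : φ g ≤ posFn φ f := by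
  refine le_csSup ⟨‖φ‖ * ‖f‖, ?_⟩ ⟨g, hg, rfl⟩
  rintro _ ⟨h, hh, rfl⟩
  exact apply_le_norm_mul (abs_apply_le_of_mem_Icc hh)

theorem posFn_le {φ : Dual C(K, ℝ)} {f : C(K, ℝ)} (hf : 0 ≤ f) {r : ℝ}
    (h : ∀ g ∈ Set.Icc 0 f, φ g ≤ r) : posFn φ f ≤ r := by
  refine csSup_le ⟨φ 0, 0, ⟨le_rfl, hf⟩, rfl⟩ ?_
  rintro _ ⟨g, hg, rfl⟩
  exact h g hg

theorem posFn_nonneg (φ : Dual C(K, ℝ)) {f : C(K, ℝ)} (hf : 0 ≤ f) : 0 ≤ posFn φ f := by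
  simpa using le_posFn φ (g := 0) ⟨le_rfl, hf⟩

theorem exists_lt_of_lt_posFn {φ : Dual C(K, ℝ)} {f : C(K, ℝ)} (hf : 0 ≤ f) {r : ℝ}
    (h : r < posFn φ f) : ∃ g ∈ Set.Icc 0 f, r < φ g := by
  by_contra! hc
  exact absurd (posFn_le hf hc) (not_le.mpr h)

/-- Riesz decomposition: any `h` in `[0, f + g]` splits as `h ⊓ f` in `[0, f]` plus a remainder in
`[0, g]`. -/
theorem posFn_add (φ : Dual C(K, ℝ)) {f g : C(K, ℝ)} (hf : 0 ≤ f) (hg : 0 ≤ g) :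
    posFn φ (f + g) = posFn φ f + posFn φ g := by
  refine le_antisymm (posFn_le (add_nonneg hf hg) fun h hh => ?_) ?_
  · have h1 : h ⊓ f ∈ Set.Icc 0 f := ⟨le_inf hh.1 hf, inf_le_right⟩
    have h2 : h - h ⊓ f ∈ Set.Icc 0 g := by
      refine ⟨sub_nonneg.mpr inf_le_left, fun t => ?_⟩
      have h3 : h t ≤ f t + g t := hh.2 t
      have h4 : 0 ≤ g t := hg t
      change h t - min (h t) (f t) ≤ g t
      rcases min_cases (h t) (f t) with hm | hm <;> linarith
    have := add_le_add (le_posFn φ h1) (le_posFn φ h2)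
    rwa [← map_add, add_sub_cancel] at this
  · rw [← le_sub_iff_add_le]
    refine posFn_le hf fun h hh => ?_
    rw [le_sub_comm]
    refine posFn_le hg fun k hk => ?_
    rw [le_sub_iff_add_le, ← map_add, add_comm k]
    exact le_posFn φ ⟨add_nonneg hh.1 hk.1, add_le_add hh.2 hk.2⟩

theorem posFn_smul_le (φ : Dual C(K, ℝ)) {a : ℝ} (ha : 0 < a) {f : C(K, ℝ)} (hf : 0 ≤ f) :
    posFn φ (a • f) ≤ a * posFn φ f := by
  refine posFn_le (smul_nonneg ha.le hf) fun g hg => ?_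
  have h1 : a⁻¹ • g ∈ Set.Icc 0 f := by
    refine ⟨smul_nonneg (by positivity) hg.1, fun t => ?_⟩
    have h2 : g t ≤ a * f t := hg.2 t
    change a⁻¹ * g t ≤ f t
    rwa [inv_mul_le_iff₀ ha]
  have := le_posFn φ h1
  rwa [map_smul, smul_eq_mul, inv_mul_le_iff₀ ha] at this

theorem posFn_zero (φ : Dual C(K, ℝ)) : posFn φ 0 = 0 := by
  refine le_antisymm (posFn_le le_rfl fun g hg => ?_) (posFn_nonneg φ le_rfl)
  rw [le_antisymm hg.2 hg.1, map_zero]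

theorem posFn_smul (φ : Dual C(K, ℝ)) {a : ℝ} (ha : 0 ≤ a) {f : C(K, ℝ)} (hf : 0 ≤ f) :
    posFn φ (a • f) = a * posFn φ f := by
  rcases ha.eq_or_lt with rfl | ha
  · rw [zero_smul, posFn_zero, zero_mul]
  refine le_antisymm (posFn_smul_le φ ha hf) ?_
  have := posFn_smul_le φ (inv_pos.mpr ha) (smul_nonneg ha.le hf)
  rwa [smul_smul, inv_mul_cancel₀ ha.ne', one_smul, le_inv_mul_iff₀ ha] at this

/-- The reflection `g ↦ f - g` maps `[0, f]` to itself. -/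
theorem posFn_sub_posFn_neg (φ : Dual C(K, ℝ)) {f : C(K, ℝ)} (hf : 0 ≤ f) :
    posFn φ f - posFn (-φ) f = φ f := by
  have key : ∀ ψ : Dual C(K, ℝ), posFn ψ f ≤ ψ f + posFn (-ψ) f := by
    intro ψ
    refine posFn_le hf fun g hg => ?_
    have : f - g ∈ Set.Icc 0 f := ⟨sub_nonneg.mpr hg.2, sub_le_self _ hg.1⟩
    have := le_posFn (-ψ) this
    rw [neg_apply, map_sub] at this
    linarith
  have h1 := key φ
  have h2 := key (-φ)
  rw [neg_neg, neg_apply] at h2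
  linarith

/-- A nonnegative function with values in `ℝ≥0`, as a real function. -/
def nnToReal (f : CompactlySupportedContinuousMap K ℝ≥0) : C(K, ℝ) :=
  ⟨fun t => (f t : ℝ), by fun_prop⟩

omit [CompactSpace K] in
theorem nnToReal_nonneg (f : CompactlySupportedContinuousMap K ℝ≥0) : 0 ≤ nnToReal f :=
  fun t => (f t).2

/-- The positive part of a functional, as an additive functional on the positive cone. -/
noncomputable def posLin (φ : Dual C(K, ℝ)) :
    CompactlySupportedContinuousMap K ℝ≥0 →ₗ[ℝ≥0] ℝ≥0 where
  toFun f := ⟨posFn φ (nnToReal f), posFn_nonneg φ (nnToReal_nonneg f)⟩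
  map_add' f g := by
    ext
    exact posFn_add φ (nnToReal_nonneg f) (nnToReal_nonneg g)
  map_smul' a f := by
    ext
    exact posFn_smul φ a.2 (nnToReal_nonneg f)

variable [T2Space K] [MeasurableSpace K] [BorelSpace K]

/-- The regular Borel measure representing the positive part of a functional. -/
noncomputable def posMeasure (φ : Dual C(K, ℝ)) : Measure K := NNRealRMK.rieszMeasure (posLin φ)

instance (φ : Dual C(K, ℝ)) : (posMeasure φ).Regular :=
  inferInstanceAs (NNRealRMK.rieszMeasure (posLin φ)).Regular

instance (φ : Dual C(K, ℝ)) : IsFiniteMeasure (posMeasure φ) := CompactSpace.isFiniteMeasure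

/-- The total variation of the measure representing a functional. -/
noncomputable def varMeasure (φ : Dual C(K, ℝ)) : Measure K := posMeasure φ + posMeasure (-φ)

instance (φ : Dual C(K, ℝ)) : IsFiniteMeasure (varMeasure φ) :=
  inferInstanceAs (IsFiniteMeasure (posMeasure φ + posMeasure (-φ)))

instance (φ : Dual C(K, ℝ)) : (varMeasure φ).Regular :=
  inferInstanceAs (posMeasure φ + posMeasure (-φ)).Regular

omit [T2Space K] in
theorem integrable_continuousMap (f : C(K, ℝ)) (μ : Measure K) [IsFiniteMeasure μ] :
    Integrable f μ :=
  f.continuous.integrable_of_hasCompactSupport (HasCompactSupport.of_compactSpace f)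

theorem integral_posMeasure (φ : Dual C(K, ℝ)) {f : C(K, ℝ)} (hf : 0 ≤ f) :
    ∫ t, f t ∂posMeasure φ = posFn φ f := by
  let g : CompactlySupportedContinuousMap K ℝ≥0 :=
    ⟨⟨fun t => (f t).toNNReal, by fun_prop⟩, HasCompactSupport.of_compactSpace _⟩
  have hg : ∀ t, (g t : ℝ) = f t := fun t => Real.coe_toNNReal _ (hf t)
  have h := NNRealRMK.integral_rieszMeasure (posLin φ) g
  have h2 : nnToReal g = f := ContinuousMap.ext hg
  simp only [hg] at h
  rw [posMeasure, h]
  change posFn φ (nnToReal g) = _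
  rw [h2]

theorem isRepresentedBy_posMeasure (φ : Dual C(K, ℝ)) :
    IsRepresentedBy φ (posMeasure φ) (posMeasure (-φ)) := by
  have key : ∀ f : C(K, ℝ), 0 ≤ f →
      φ f = (∫ t, f t ∂posMeasure φ) - ∫ t, f t ∂posMeasure (-φ) := fun f hf => by
    rw [integral_posMeasure φ hf, integral_posMeasure (-φ) hf, posFn_sub_posFn_neg φ hf]
  intro f
  have hf : f = f ⊔ 0 - (-f) ⊔ 0 := by
    ext t
    simp only [ContinuousMap.sub_apply, ContinuousMap.sup_apply, ContinuousMap.neg_apply,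
      ContinuousMap.zero_apply]
    rcases max_cases (f t) 0 with h | h <;> rcases max_cases (-f t) 0 with h' | h' <;> linarith
  have h1 := key (f ⊔ 0) le_sup_right
  have h2 := key ((-f) ⊔ 0) le_sup_right
  have h3 : ∀ (μ : Measure K) [IsFiniteMeasure μ],
      ∫ t, f t ∂μ = (∫ t, (f ⊔ 0) t ∂μ) - ∫ t, ((-f) ⊔ 0) t ∂μ := by
    intro μ _
    rw [← integral_sub (integrable_continuousMap _ _) (integrable_continuousMap _ _)]
    refine integral_congr_ae (ae_of_all _ fun t => ?_)
    exact congrArg (fun g : C(K, ℝ) => g t) hf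
  rw [h3 (posMeasure φ), h3 (posMeasure (-φ)), hf, map_sub, ← hf, h1, h2]
  ring

theorem integral_varMeasure (φ : Dual C(K, ℝ)) (f : C(K, ℝ)) :
    ∫ t, f t ∂varMeasure φ = (∫ t, f t ∂posMeasure φ) + ∫ t, f t ∂posMeasure (-φ) :=
  integral_add_measure (integrable_continuousMap _ _) (integrable_continuousMap _ _)

theorem varMeasure_real_apply (φ : Dual C(K, ℝ)) (S : Set K) :
    (varMeasure φ).real S = (posMeasure φ).real S + (posMeasure (-φ)).real S :=
  measureReal_add_apply

theorem apply_le_integral_varMeasure (φ : Dual C(K, ℝ)) {f g : C(K, ℝ)} (h : ∀ t, |g t| ≤ f t) :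
    φ g ≤ ∫ t, f t ∂varMeasure φ := by
  rw [isRepresentedBy_posMeasure φ g, integral_varMeasure, sub_eq_add_neg, ← integral_neg]
  refine add_le_add (integral_mono (integrable_continuousMap _ _) (integrable_continuousMap _ _)
    fun t => (abs_le.mp (h t)).2) (integral_mono (integrable_continuousMap _ _).neg
    (integrable_continuousMap _ _) fun t => ?_)
  have := (abs_le.mp (h t)).1
  simp only
  linarith

/-- The difference of near-maximizers for the positive and the negative part works: both lie in `[0,
f]`, so it stays in `[-f, f]`. -/
theorem exists_lt_of_lt_integral_varMeasure (φ : Dual C(K, ℝ)) {f : C(K, ℝ)} (hf : 0 ≤ f) {r : ℝ}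
    (hr : r < ∫ t, f t ∂varMeasure φ) : ∃ g : C(K, ℝ), (∀ t, |g t| ≤ f t) ∧ r < φ g := by
  rw [integral_varMeasure, integral_posMeasure φ hf, integral_posMeasure (-φ) hf] at hr
  set ε := (posFn φ f + posFn (-φ) f - r) / 2 with hε
  obtain ⟨g, hg, hgl⟩ := exists_lt_of_lt_posFn hf (show posFn φ f - ε < posFn φ f by linarith)
  obtain ⟨h, hh, hhl⟩ :=
    exists_lt_of_lt_posFn hf (show posFn (-φ) f - ε < posFn (-φ) f by linarith)
  refine ⟨g - h, fun t => ?_, ?_⟩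
  · have h1 : 0 ≤ g t := hg.1 t
    have h2 : g t ≤ f t := hg.2 t
    have h3 : 0 ≤ h t := hh.1 t
    have h4 : h t ≤ f t := hh.2 t
    rw [ContinuousMap.sub_apply, abs_le]
    constructor <;> linarith
  · rw [neg_apply] at hhl
    rw [map_sub]
    linarith

theorem varMeasure_univ (φ : Dual C(K, ℝ)) : (varMeasure φ).real Set.univ = ‖φ‖ := by
  have h1 : ∫ t, (1 : C(K, ℝ)) t ∂varMeasure φ = (varMeasure φ).real Set.univ := by simp
  refine le_antisymm ?_ ?_
  · rw [← h1]
    by_contra! hlt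
    obtain ⟨g, hg, hgl⟩ := exists_lt_of_lt_integral_varMeasure φ (f := 1) zero_le_one hlt
    refine absurd ((le_abs_self _).trans (φ.le_opNorm g)) (not_le.mpr ?_)
    refine lt_of_le_of_lt (mul_le_of_le_one_right (norm_nonneg _) ?_) hgl
    exact (ContinuousMap.norm_le _ zero_le_one).mpr hg
  · refine φ.opNorm_le_bound measureReal_nonneg fun f => ?_
    have key : ∀ g : C(K, ℝ), ‖g‖ ≤ ‖f‖ → φ g ≤ (varMeasure φ).real Set.univ * ‖f‖ := fun g hg => by
      have := apply_le_integral_varMeasure φ (f := ‖f‖ • (1 : C(K, ℝ))) (g := g) fun t => by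
        simpa using (g.norm_coe_le_norm t).trans hg
      simpa using this
    rw [Real.norm_eq_abs, abs_le]
    refine ⟨?_, key f le_rfl⟩
    have := key (-f) (norm_neg f).le
    rw [map_neg] at this
    linarith

omit [T2Space K] in
theorem isRepresentedBy_add {φ ψ : Dual C(K, ℝ)} {μ ν μ' ν' : Measure K} [IsFiniteMeasure μ]
    [IsFiniteMeasure ν] [IsFiniteMeasure μ'] [IsFiniteMeasure ν'] (h : IsRepresentedBy φ μ ν)
    (h' : IsRepresentedBy ψ μ' ν') : IsRepresentedBy (φ + ψ) (μ + μ') (ν + ν') := by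
  intro f
  rw [integral_add_measure (integrable_continuousMap _ _) (integrable_continuousMap _ _),
    integral_add_measure (integrable_continuousMap _ _) (integrable_continuousMap _ _),
    add_apply, h f, h' f]
  ring

theorem measure_ext_of_integral_continuousMap {μ ν : Measure K} [μ.Regular] [ν.Regular]
    (h : ∀ f : C(K, ℝ), ∫ t, f t ∂μ = ∫ t, f t ∂ν) : μ = ν :=
  Measure.ext_of_integral_eq_on_compactlySupported fun f => h f.toContinuousMap

/-- The regular signed measure representing a functional is unique. -/
theorem IsRepresentedBy.real_sub_real {φ : Dual C(K, ℝ)} {μ ν : Measure K} [IsFiniteMeasure μ]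
    [IsFiniteMeasure ν] [μ.Regular] [ν.Regular] (h : IsRepresentedBy φ μ ν) (S : Set K) :
    μ.real S - ν.real S = (posMeasure φ).real S - (posMeasure (-φ)).real S := by
  -- Moving the negative parts across leaves an identity between positive regular measures.
  have hm : μ + posMeasure (-φ) = posMeasure φ + ν := by
    refine measure_ext_of_integral_continuousMap fun f => ?_
    rw [integral_add_measure (integrable_continuousMap _ _) (integrable_continuousMap _ _),
      integral_add_measure (integrable_continuousMap _ _) (integrable_continuousMap _ _)]
    have h1 := h f
    have h2 := isRepresentedBy_posMeasure φ f
    linarith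
  have := congrArg (fun m : Measure K => m.real S) hm
  change (μ + posMeasure (-φ)).real S = (posMeasure φ + ν).real S at this
  rw [measureReal_add_apply, measureReal_add_apply] at this
  linarith

/-- The functional `μ ↦ μ(S)` on the dual of `C(K)`. -/
noncomputable def indicatorFunctional (S : Set K) : Dual (Dual C(K, ℝ)) :=
  LinearMap.mkContinuous
    (IsLinearMap.mk' (fun φ : Dual C(K, ℝ) => (posMeasure φ).real S - (posMeasure (-φ)).real S)
      { map_add := fun φ ψ => by
          -- `posMeasure` is not additive; linearity comes from uniqueness of the represented signed
          -- measure.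
          rw [← (isRepresentedBy_add (isRepresentedBy_posMeasure φ)
            (isRepresentedBy_posMeasure ψ)).real_sub_real S, measureReal_add_apply,
            measureReal_add_apply]
          ring
        map_smul := fun a φ => by
          have key : ∀ (a : ℝ≥0) (φ : Dual C(K, ℝ)),
              (posMeasure ((a : ℝ) • φ)).real S - (posMeasure (-((a : ℝ) • φ))).real S =
                a * ((posMeasure φ).real S - (posMeasure (-φ)).real S) := by
            intro a φ
            have h : IsRepresentedBy ((a : ℝ) • φ) (a • posMeasure φ) (a • posMeasure (-φ)) := by
              intro f
              rw [integral_smul_nnreal_measure, integral_smul_nnreal_measure, smul_apply,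
                isRepresentedBy_posMeasure φ f]
              simp only [smul_eq_mul, NNReal.smul_def]
              ring
            rw [← h.real_sub_real S, measureReal_nnreal_smul_apply, measureReal_nnreal_smul_apply]
            ring
          rcases le_total 0 a with ha | ha
          · exact key ⟨a, ha⟩ φ
          · have h1 := key ⟨-a, by linarith⟩ φ
            have h2 : (-a) • φ = -(a • φ) := by ext; simp
            change (posMeasure ((-a) • φ)).real S - (posMeasure (-((-a) • φ))).real S =
              (-a) * _ at h1
            rw [h2, neg_neg] at h1
            rw [smul_eq_mul]
            linarith })
    1 fun φ => by
      have h1 : (posMeasure φ).real S ≤ (posMeasure φ).real Set.univ :=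
        measureReal_mono (Set.subset_univ S)
      have h2 : (posMeasure (-φ)).real S ≤ (posMeasure (-φ)).real Set.univ :=
        measureReal_mono (Set.subset_univ S)
      have h3 : 0 ≤ (posMeasure φ).real S := measureReal_nonneg
      have h4 : 0 ≤ (posMeasure (-φ)).real S := measureReal_nonneg
      have h5 := varMeasure_real_apply φ Set.univ
      rw [one_mul, ← varMeasure_univ φ, IsLinearMap.mk'_apply, Real.norm_eq_abs, abs_le]
      constructor <;> linarith

theorem indicatorFunctional_apply (S : Set K) (φ : Dual C(K, ℝ)) :
    indicatorFunctional S φ = (posMeasure φ).real S - (posMeasure (-φ)).real S := rfl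

/-- Each set thus contributes exactly one generator to `indicatorSpan`. -/
theorem isIndicatorFunctional_iff {S : Set K} {ξ : Dual (Dual C(K, ℝ))} :
    IsIndicatorFunctional S ξ ↔ ξ = indicatorFunctional S := by
  constructor
  · intro h
    ext φ
    exact h φ _ _ inferInstance inferInstance inferInstance inferInstance
      (isRepresentedBy_posMeasure φ)
  · rintro rfl φ μ ν _ _ _ _ h
    rw [indicatorFunctional_apply, h.real_sub_real S]

end PositivePart

/-! ### Legitimate pairs and step functions. -/

/-- A closed set together with a family of pairwise disjoint relatively open subsets. -/
structure IsLegitimatePair {X : Type*} [TopologicalSpace X] (A : Set X) (ℋ : Set (Set X)) :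
    Prop where
  isClosed : IsClosed A
  relOpen : ∀ H ∈ ℋ, ∃ O, IsOpen O ∧ H = A ∩ O
  disjoint : ∀ H ∈ ℋ, ∀ H' ∈ ℋ, H ≠ H' → Disjoint H H'

namespace IsLegitimatePair

variable {X : Type*} [TopologicalSpace X] {A : Set X} {ℋ : Set (Set X)}

theorem subset (h : IsLegitimatePair A ℋ) (H : ℋ) : (H : Set X) ⊆ A := by
  obtain ⟨O, -, hO⟩ := h.relOpen H H.2
  rw [hO]; exact Set.inter_subset_left

/-- The sets `H` need not be open. This weaker openness is what allows Urysohn functions for compact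
subsets of `H`. -/
theorem isOpen_union_compl (h : IsLegitimatePair A ℋ) (H : ℋ) : IsOpen ((H : Set X) ∪ Aᶜ) := by
  obtain ⟨O, hO, hHO⟩ := h.relOpen H H.2
  have : (H : Set X) ∪ Aᶜ = O ∪ Aᶜ := by
    rw [hHO]; ext t; by_cases ht : t ∈ A <;> simp [ht]
  rw [this]; exact hO.union h.isClosed.isOpen_compl

theorem pairwise_disjoint (h : IsLegitimatePair A ℋ) :
    Pairwise (Function.onFun Disjoint fun H : ℋ => (H : Set X)) := fun H H' hne =>
  h.disjoint H H.2 H' H'.2 fun heq => hne (Subtype.ext heq)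

theorem measurableSet [MeasurableSpace X] [BorelSpace X] (h : IsLegitimatePair A ℋ) (H : ℋ) :
    MeasurableSet (H : Set X) := by
  obtain ⟨O, hO, hHO⟩ := h.relOpen H H.2
  rw [hHO]; exact h.isClosed.measurableSet.inter hO.measurableSet

end IsLegitimatePair

/-- The simple function `1_{S₀} + ∑ cᵢ 1_{Sᵢ}`. -/
noncomputable def stepFn {X ι : Type*} (S₀ : Set X) (F : Finset ι) (c : ι → ℝ) (S : ι → Set X)
    (t : X) : ℝ :=
  S₀.indicator 1 t + ∑ i ∈ F, c i * (S i).indicator 1 t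

theorem stepFn_mono {X ι : Type*} {S₀ S₀' : Set X} {F : Finset ι} {c : ι → ℝ} {S S' : ι → Set X}
    (hc : ∀ i, 0 ≤ c i) (h₀ : S₀ ⊆ S₀') (h : ∀ i, S i ⊆ S' i) (t : X) :
    stepFn S₀ F c S t ≤ stepFn S₀' F c S' t :=
  add_le_add (Set.indicator_le_indicator_of_subset h₀ (fun _ => zero_le_one) t)
    (Finset.sum_le_sum fun i _ => mul_le_mul_of_nonneg_left
      (Set.indicator_le_indicator_of_subset (h i) (fun _ => zero_le_one) t) (hc i))

section Measure

variable {X ι : Type*} [MeasurableSpace X] (μ : Measure X) [IsFiniteMeasure μ]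

theorem integrable_indicator_one' {S : Set X} (hS : MeasurableSet S) :
    Integrable (S.indicator (1 : X → ℝ)) μ :=
  (integrable_const (1 : ℝ)).indicator hS

theorem integrable_stepFn {S₀ : Set X} {S : ι → Set X} (F : Finset ι) (c : ι → ℝ)
    (h₀ : MeasurableSet S₀) (h : ∀ i, MeasurableSet (S i)) : Integrable (stepFn S₀ F c S) μ :=
  (integrable_indicator_one' μ h₀).add
    (integrable_finsetSum _ fun i _ => (integrable_indicator_one' μ (h i)).const_mul _)

theorem integral_stepFn {S₀ : Set X} {S : ι → Set X} (F : Finset ι) (c : ι → ℝ)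
    (h₀ : MeasurableSet S₀) (h : ∀ i, MeasurableSet (S i)) :
    ∫ t, stepFn S₀ F c S t ∂μ = μ.real S₀ + ∑ i ∈ F, c i * μ.real (S i) := by
  unfold stepFn
  rw [integral_add (integrable_indicator_one' μ h₀)
    (integrable_finsetSum _ fun i _ => (integrable_indicator_one' μ (h i)).const_mul _),
    integral_finsetSum _ fun i _ => (integrable_indicator_one' μ (h i)).const_mul _,
    integral_indicator_one h₀]
  congr 1
  refine Finset.sum_congr rfl fun i _ => ?_
  rw [integral_const_mul, integral_indicator_one (h i)]

end Measure

/-! ### The gauge of a legitimate pair as a support function. -/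

section Pair

variable {K : Type*} [TopologicalSpace K] {A : Set K} {ℋ : Set (Set K)}

/-- By disjointness at most one term is nonzero at `t`, and each coefficient is at most `1`. -/
theorem stepFn_le_one (hp : IsLegitimatePair A ℋ) {F : Finset ℋ} {c : ℋ → ℝ}
    (hc1 : ∑ H ∈ F, c H ^ 2 ≤ 1) (t : K) : stepFn Aᶜ F c (fun H => (H : Set K)) t ≤ 1 := by
  unfold stepFn
  by_cases ht : t ∈ A
  · rw [Set.indicator_of_notMem (by simpa using ht), zero_add]
    by_cases hH : ∃ H ∈ F, t ∈ (H : Set K)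
    · obtain ⟨H, hHF, htH⟩ := hH
      rw [Finset.sum_eq_single_of_mem H hHF]
      · rw [Set.indicator_of_mem htH, Pi.one_apply, mul_one]
        have h1 : c H ^ 2 ≤ 1 :=
          (Finset.single_le_sum (f := fun H => c H ^ 2) (fun _ _ => sq_nonneg _) hHF).trans hc1
        exact (abs_le_one_iff_mul_self_le_one.mpr (by rwa [← sq]) |> (abs_le.mp ·)).2
      · intro H' _ hne
        rw [Set.indicator_of_notMem, mul_zero]
        exact fun htH' => (hp.pairwise_disjoint hne).le_bot ⟨htH', htH⟩
    · push Not at hH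
      rw [Finset.sum_eq_zero]
      · exact zero_le_one
      · intro H hHF
        rw [Set.indicator_of_notMem (hH H hHF), mul_zero]
  · rw [Set.indicator_of_mem (by simpa using ht), Finset.sum_eq_zero]
    · simp
    · intro H _
      rw [Set.indicator_of_notMem (fun h => ht (hp.subset H h)), mul_zero]

/-- The nonnegative continuous functions dominated by `1_{Aᶜ} + ∑ c_H 1_H` for some finitely
supported coefficients `c` in the unit ball of `ℓ²(ℋ)`. -/
def posSet (A : Set K) (ℋ : Set (Set K)) : Set C(K, ℝ) :=
  {h | 0 ≤ h ∧ ∃ (F : Finset ℋ) (c : ℋ → ℝ), (∀ H, 0 ≤ c H) ∧ ∑ H ∈ F, c H ^ 2 ≤ 1 ∧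
    ∀ t, h t ≤ stepFn Aᶜ F c (fun H => (H : Set K)) t}

/-- The continuous functions with absolute value in `posSet A ℋ`. -/
def absSet (A : Set K) (ℋ : Set (Set K)) : Set C(K, ℝ) := {h | |h| ∈ posSet A ℋ}

/-- Solidity lets a near-maximizer for the positive part or the variation at some `f ∈ posSet A ℋ`
stay in the set. -/
theorem posSet_of_le {f g : C(K, ℝ)} (hf : f ∈ posSet A ℋ) (hg : 0 ≤ g) (hgf : g ≤ f) :
    g ∈ posSet A ℋ := by
  obtain ⟨-, F, c, hc, hc1, h⟩ := hf
  exact ⟨hg, F, c, hc, hc1, fun t => (hgf t).trans (h t)⟩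

theorem zero_mem_posSet : 0 ∈ posSet A ℋ :=
  ⟨le_rfl, ∅, 0, fun _ => le_rfl, by simp, fun t => by
    simp only [stepFn, Finset.sum_empty, add_zero]
    exact Set.indicator_nonneg (fun _ _ => zero_le_one) t⟩

variable [CompactSpace K]

theorem isUnitSubset_posSet (hp : IsLegitimatePair A ℋ) : IsUnitSubset (posSet A ℋ) := by
  refine ⟨zero_mem_posSet, ?_⟩
  rintro f ⟨hf0, F, c, -, hc1, hf⟩
  refine (ContinuousMap.norm_le _ zero_le_one).mpr fun t => ?_
  rw [Real.norm_of_nonneg (show 0 ≤ f t from hf0 t)]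
  exact (hf t).trans (stepFn_le_one hp hc1 t)

theorem isUnitSubset_absSet (hp : IsLegitimatePair A ℋ) : IsUnitSubset (absSet A ℋ) := by
  refine ⟨by simpa [absSet] using zero_mem_posSet, fun f hf => ?_⟩
  exact (norm_le_of_forall_abs_le fun t => le_rfl).trans
    ((isUnitSubset_posSet hp).norm_le |f| hf)

variable [MeasurableSpace K] [BorelSpace K]

omit [CompactSpace K] in
theorem sum_measureReal_le (hp : IsLegitimatePair A ℋ) (μ : Measure K) [IsFiniteMeasure μ]
    (F : Finset ℋ) : ∑ H ∈ F, μ.real (H : Set K) ≤ μ.real Set.univ := by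
  rw [← measureReal_biUnion_finset (fun H _ H' _ hne => hp.pairwise_disjoint hne)
    fun H _ => hp.measurableSet H]
  exact measureReal_mono (Set.subset_univ _)

omit [CompactSpace K] in
theorem sum_measureReal_sq_le (hp : IsLegitimatePair A ℋ) (μ : Measure K) [IsFiniteMeasure μ]
    (F : Finset ℋ) :
    ∑ H ∈ F, ‖μ.real (H : Set K)‖ ^ (2 : ENNReal).toReal ≤
      μ.real Set.univ ^ (2 : ENNReal).toReal := by
  simp only [ENNReal.toReal_ofNat, Real.rpow_two, Real.norm_eq_abs, sq_abs]
  calc ∑ H ∈ F, μ.real (H : Set K) ^ 2 ≤ ∑ H ∈ F, μ.real Set.univ * μ.real (H : Set K) := by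
        refine Finset.sum_le_sum fun H _ => ?_
        rw [sq]
        exact mul_le_mul_of_nonneg_right (measureReal_mono (Set.subset_univ _)) measureReal_nonneg
    _ ≤ μ.real Set.univ ^ 2 := by
        rw [← Finset.mul_sum, sq]
        exact mul_le_mul_of_nonneg_left (sum_measureReal_le hp μ F) measureReal_nonneg

/-- The vector of the measures of the members of `ℋ`, in `ℓ²(ℋ)`. -/
noncomputable def measureVec (hp : IsLegitimatePair A ℋ) (μ : Measure K) [IsFiniteMeasure μ] :
    lp (fun _ : ℋ => ℝ) 2 :=
  ⟨fun H => μ.real (H : Set K), memℓp_gen' (sum_measureReal_sq_le hp μ)⟩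

omit [CompactSpace K] in
theorem norm_measureVec_le (hp : IsLegitimatePair A ℋ) (μ : Measure K) [IsFiniteMeasure μ] :
    ‖measureVec hp μ‖ ≤ μ.real Set.univ :=
  lp.norm_le_of_forall_sum_le (by norm_num) measureReal_nonneg (sum_measureReal_sq_le hp μ)

omit [CompactSpace K] in
theorem measureVec_add (hp : IsLegitimatePair A ℋ) (μ ν : Measure K) [IsFiniteMeasure μ]
    [IsFiniteMeasure ν] : measureVec hp (μ + ν) = measureVec hp μ + measureVec hp ν := by
  ext H
  exact measureReal_add_apply

/-- The function `μ ↦ μ(Aᶜ) + (∑ μ(H)²)^{1/2}` on positive measures. -/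
noncomputable def pairGauge (hp : IsLegitimatePair A ℋ) (μ : Measure K) [IsFiniteMeasure μ] : ℝ :=
  μ.real Aᶜ + ‖measureVec hp μ‖

/-- Cauchy–Schwarz between the coefficients and the masses of the members. -/
theorem integral_le_pairGauge (hp : IsLegitimatePair A ℋ) (μ : Measure K) [IsFiniteMeasure μ]
    {h : C(K, ℝ)} (hh : h ∈ posSet A ℋ) : ∫ t, h t ∂μ ≤ pairGauge hp μ := by
  obtain ⟨-, F, c, hc, hc1, hle⟩ := hh
  have hA : MeasurableSet Aᶜ := hp.isClosed.measurableSet.compl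
  refine (integral_mono (integrable_continuousMap h μ)
    (integrable_stepFn μ F c hA hp.measurableSet) hle).trans ?_
  rw [integral_stepFn μ F c hA hp.measurableSet]
  refine add_le_add le_rfl ((Real.sum_mul_le_sqrt_mul_sqrt F _ _).trans ?_)
  have h1 : √(∑ H ∈ F, c H ^ 2) ≤ 1 := Real.sqrt_le_one.mpr hc1
  have h2 : √(∑ H ∈ F, μ.real (H : Set K) ^ 2) ≤ ‖measureVec hp μ‖ := by
    refine Real.sqrt_le_iff.mpr ⟨norm_nonneg _, ?_⟩
    have := lp.sum_rpow_le_norm_rpow (by norm_num) (measureVec hp μ) F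
    simp only [ENNReal.toReal_ofNat, Real.rpow_two, Real.norm_eq_abs, sq_abs] at this
    exact this
  calc _ ≤ 1 * ‖measureVec hp μ‖ :=
        mul_le_mul h1 h2 (Real.sqrt_nonneg _) zero_le_one
    _ = _ := one_mul _

omit [CompactSpace K] [BorelSpace K] in
theorem exists_isCompact_measureReal_lt (μ : Measure K) [IsFiniteMeasure μ] [μ.Regular]
    {S : Set K} (hS : MeasurableSet S) {ε : ℝ} (hε : 0 < ε) :
    ∃ C ⊆ S, IsCompact C ∧ μ.real S - ε < μ.real C := by
  obtain ⟨C, hCS, hC, hlt⟩ := hS.exists_isCompact_lt_add (measure_ne_top μ S)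
    (ε := ENNReal.ofReal ε) (by simpa using hε)
  refine ⟨C, hCS, hC, ?_⟩
  have h := (ENNReal.toReal_lt_toReal (measure_ne_top μ S)
    (ENNReal.add_ne_top.mpr ⟨measure_ne_top μ C, ENNReal.ofReal_ne_top⟩)).mpr hlt
  rw [ENNReal.toReal_add (measure_ne_top μ C) ENNReal.ofReal_ne_top,
    ENNReal.toReal_ofReal hε.le] at h
  rw [measureReal_def, measureReal_def]
  linarith

variable [T2Space K]

theorem exists_posSet_lt_integral_of_lt_stepFn (hp : IsLegitimatePair A ℋ) (μ : Measure K)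
    [IsFiniteMeasure μ] [μ.Regular] {F : Finset ℋ} {c : ℋ → ℝ} (hc : ∀ H, 0 ≤ c H)
    (hc1 : ∑ H ∈ F, c H ^ 2 ≤ 1) {r : ℝ}
    (hr : r < μ.real Aᶜ + ∑ H ∈ F, c H * μ.real (H : Set K)) :
    ∃ f ∈ posSet A ℋ, r < ∫ t, f t ∂μ := by
  set τ := μ.real Aᶜ + ∑ H ∈ F, c H * μ.real (H : Set K) with hτ
  set W := ∑ H ∈ F, c H with hW
  have hW0 : 0 ≤ W := Finset.sum_nonneg fun H _ => hc H
  set ε := (τ - r) / (2 * (1 + W)) with hε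
  have hε0 : 0 < ε := div_pos (by linarith) (by linarith)
  have hεW : ε * (1 + W) < τ - r := by
    rw [hε, div_mul_eq_mul_div, div_lt_iff₀ (by linarith)]
    nlinarith
  obtain ⟨C₀, hC₀A, hC₀, hC₀l⟩ :=
    exists_isCompact_measureReal_lt μ hp.isClosed.measurableSet.compl hε0
  have hC := fun H : ℋ => exists_isCompact_measureReal_lt μ (hp.measurableSet H) hε0
  choose C hCH hCc hCl using hC
  obtain ⟨f₀, hf₀0, hf₀1, hf₀⟩ := exists_continuous_zero_one_of_isCompact' hC₀ hp.isClosed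
    (Set.disjoint_left.mpr fun t h1 h2 => hC₀A h1 h2)
  have hf := fun H : ℋ => exists_continuous_zero_one_of_isCompact' (hCc H)
    (hp.isOpen_union_compl H).isClosed_compl
    (Set.disjoint_left.mpr fun t h1 h2 => h2 (Or.inl (hCH H h1)))
  choose f hf0 hf1 hf using hf
  -- Inside `A` each `f H` vanishes off `H`. On `Aᶜ` the functions may overlap, and cutting off at
  -- `1` restores the bound.
  let g : C(K, ℝ) := 1 ⊓ (f₀ + ∑ H ∈ F, c H • f H)
  have hg : ∀ t, g t = min 1 (f₀ t + ∑ H ∈ F, c H * f H t) := fun t => by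
    simp [g, ContinuousMap.inf_apply, ContinuousMap.sum_apply]
  refine ⟨g, ⟨fun t => ?_, F, c, hc, hc1, fun t => ?_⟩, ?_⟩
  · change 0 ≤ g t
    rw [hg]
    refine le_min zero_le_one (add_nonneg (hf₀ t).1 (Finset.sum_nonneg fun H _ => ?_))
    exact mul_nonneg (hc H) (hf H t).1
  · rw [hg, stepFn]
    by_cases ht : t ∈ A
    · refine (min_le_right _ _).trans (add_le_add ?_ (Finset.sum_le_sum fun H _ => ?_))
      · rw [hf₀0 ht]; exact Set.indicator_nonneg (fun _ _ => zero_le_one) t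
      · refine mul_le_mul_of_nonneg_left ?_ (hc H)
        by_cases htH : t ∈ (H : Set K)
        · rw [Set.indicator_of_mem htH]; exact (hf H t).2
        · rw [hf0 H (show t ∈ ((H : Set K) ∪ Aᶜ)ᶜ by simp [ht, htH])]
          exact Set.indicator_nonneg (fun _ _ => zero_le_one) t
    · refine (min_le_left _ _).trans ?_
      rw [Set.indicator_of_mem (by simpa using ht), Pi.one_apply, le_add_iff_nonneg_right]
      exact Finset.sum_nonneg fun H _ =>
        mul_nonneg (hc H) (Set.indicator_nonneg (fun _ _ => zero_le_one) t)
  · have hle : ∀ t, stepFn C₀ F c C t ≤ g t := by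
      intro t
      rw [hg]
      refine le_min ((stepFn_mono hc hC₀A hCH t).trans (stepFn_le_one hp hc1 t)) ?_
      refine add_le_add ?_ (Finset.sum_le_sum fun H _ => mul_le_mul_of_nonneg_left ?_ (hc H))
      · exact Set.indicator_le' (fun t ht => (hf₀1 ht).ge) (fun t _ => (hf₀ t).1) t
      · exact Set.indicator_le' (fun t ht => (hf1 H ht).ge) (fun t _ => (hf H t).1) t
    refine lt_of_lt_of_le ?_ (integral_mono (integrable_stepFn μ F c hC₀.measurableSet
      fun H => (hCc H).measurableSet) (integrable_continuousMap g μ) hle)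
    rw [integral_stepFn μ F c hC₀.measurableSet fun H => (hCc H).measurableSet]
    have h1 : ∑ H ∈ F, c H * (μ.real (H : Set K) - ε) ≤ ∑ H ∈ F, c H * μ.real (C H) :=
      Finset.sum_le_sum fun H _ => mul_le_mul_of_nonneg_left (hCl H).le (hc H)
    have h2 : ∑ H ∈ F, c H * (μ.real (H : Set K) - ε) =
        ∑ H ∈ F, c H * μ.real (H : Set K) - ε * W := by
      rw [hW, Finset.mul_sum, ← Finset.sum_sub_distrib]
      exact Finset.sum_congr rfl fun H _ => by ring
    linarith

theorem exists_posSet_lt_integral (hp : IsLegitimatePair A ℋ) (μ : Measure K) [IsFiniteMeasure μ]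
    [μ.Regular] {r : ℝ} (hr : r < pairGauge hp μ) : ∃ f ∈ posSet A ℋ, r < ∫ t, f t ∂μ := by
  have hsum := lp.hasSum_norm (by norm_num) (measureVec hp μ)
  simp only [ENNReal.toReal_ofNat, Real.rpow_two, Real.norm_eq_abs, sq_abs] at hsum
  have hlim : Tendsto (fun F : Finset ℋ => √(∑ H ∈ F, μ.real (H : Set K) ^ 2)) atTop
      (𝓝 ‖measureVec hp μ‖) := by
    have := hsum.sqrt
    rw [Real.sqrt_sq (norm_nonneg _), SummationFilter.unconditional_filter] at this
    exact this
  obtain ⟨F, hF⟩ := (hlim.eventually (lt_mem_nhds (sub_left_lt_of_lt_add hr))).exists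
  set s := √(∑ H ∈ F, μ.real (H : Set K) ^ 2) with hs
  have hs2 : s ^ 2 = ∑ H ∈ F, μ.real (H : Set K) ^ 2 :=
    Real.sq_sqrt (Finset.sum_nonneg fun H _ => sq_nonneg _)
  -- These coefficients give equality in Cauchy–Schwarz; if `s = 0`, division by zero makes them
  -- vanish and both goals still hold.
  refine exists_posSet_lt_integral_of_lt_stepFn hp μ (F := F) (c := fun H => μ.real (H : Set K) / s)
    (fun H => div_nonneg measureReal_nonneg (Real.sqrt_nonneg _)) ?_ ?_
  · simp only [div_pow]
    rw [← Finset.sum_div, ← hs2]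
    exact div_self_le_one _
  · have : ∑ H ∈ F, μ.real (H : Set K) / s * μ.real (H : Set K) = s := by
      have h1 : ∀ H : ℋ, μ.real (H : Set K) / s * μ.real (H : Set K) = μ.real (H : Set K) ^ 2 / s :=
        fun H => by ring
      simp only [h1]
      rw [← Finset.sum_div, ← hs2, sq, mul_self_div_self]
    rw [this]
    linarith

theorem supportFn_posSet (hp : IsLegitimatePair A ℋ) (φ : Dual C(K, ℝ)) :
    supportFn (posSet A ℋ) φ = pairGauge hp (posMeasure φ) := by
  have hU := isUnitSubset_posSet hp
  refine le_antisymm (hU.supportFn_le fun h hh => ?_) ?_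
  · refine (le_posFn φ ⟨hh.1, le_rfl⟩).trans ?_
    rw [← integral_posMeasure φ hh.1]
    exact integral_le_pairGauge hp _ hh
  · by_contra! hlt
    obtain ⟨f, hf, hlt⟩ := exists_posSet_lt_integral hp _ hlt
    rw [integral_posMeasure φ hf.1] at hlt
    obtain ⟨g, hg, hlt⟩ := exists_lt_of_lt_posFn hf.1 hlt
    exact absurd (hU.le_supportFn φ (posSet_of_le hf hg.1 hg.2)) (not_le.mpr hlt)

theorem supportFn_absSet (hp : IsLegitimatePair A ℋ) (φ : Dual C(K, ℝ)) :
    supportFn (absSet A ℋ) φ = pairGauge hp (varMeasure φ) := by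
  have hU := isUnitSubset_absSet hp
  refine le_antisymm (hU.supportFn_le fun h hh => ?_) ?_
  · exact (apply_le_integral_varMeasure φ fun t => le_rfl).trans
      (integral_le_pairGauge hp (varMeasure φ) (h := |h|) hh)
  · by_contra! hlt
    obtain ⟨f, hf, hlt⟩ := exists_posSet_lt_integral hp _ hlt
    obtain ⟨g, hg, hlt⟩ := exists_lt_of_lt_integral_varMeasure φ hf.1 hlt
    exact absurd (hU.le_supportFn φ (posSet_of_le hf (abs_nonneg g) hg)) (not_le.mpr hlt)

/-- Positive parts are only subadditive. This inequality lets the additivity defect of the support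
functions control that of the gauge on measures. -/
theorem supportFn_posSet_add_le (hp : IsLegitimatePair A ℋ) (φ ψ : Dual C(K, ℝ)) :
    supportFn (posSet A ℋ) (φ + ψ) ≤ pairGauge hp (posMeasure φ + posMeasure ψ) := by
  refine (isUnitSubset_posSet hp).supportFn_le fun h hh => ?_
  refine le_trans ?_ (integral_le_pairGauge hp _ hh)
  rw [integral_add_measure (integrable_continuousMap _ _) (integrable_continuousMap _ _),
    integral_posMeasure φ hh.1, integral_posMeasure ψ hh.1]
  exact add_le_add (le_posFn φ ⟨hh.1, le_rfl⟩) (le_posFn ψ ⟨hh.1, le_rfl⟩)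

theorem supportFn_absSet_add_le (hp : IsLegitimatePair A ℋ) (φ ψ : Dual C(K, ℝ)) :
    supportFn (absSet A ℋ) (φ + ψ) ≤ pairGauge hp (varMeasure φ + varMeasure ψ) := by
  refine (isUnitSubset_absSet hp).supportFn_le fun h hh => ?_
  refine le_trans ?_ (integral_le_pairGauge hp _ (h := |h|) hh)
  rw [integral_add_measure (integrable_continuousMap _ _) (integrable_continuousMap _ _)]
  exact add_le_add (apply_le_integral_varMeasure φ fun t => le_rfl)
    (apply_le_integral_varMeasure ψ fun t => le_rfl)

omit [CompactSpace K] [T2Space K] in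
/-- Uniform rotundity of the gauge of a legitimate pair, evaluated on the members of the family. -/
theorem tendsto_measureReal_sub (hp : IsLegitimatePair A ℋ) {μ ν : ℕ → Measure K}
    [∀ k, IsFiniteMeasure (μ k)] [∀ k, IsFiniteMeasure (ν k)] {M : ℝ}
    (hμ : ∀ k, (μ k).real Set.univ ≤ M) (hν : ∀ k, (ν k).real Set.univ ≤ M) {s : ℕ → ℝ}
    (hs : ∀ k, s k ≤ pairGauge hp (μ k + ν k))
    (hA : Tendsto (fun k => (μ k).real Aᶜ - (ν k).real Aᶜ) atTop (𝓝 0))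
    (hsub : Tendsto (fun k => pairGauge hp (μ k) - pairGauge hp (ν k)) atTop (𝓝 0))
    (hadd : Tendsto (fun k => pairGauge hp (μ k) + pairGauge hp (ν k) - s k) atTop (𝓝 0))
    {H : Set K} (hH : H ∈ ℋ) :
    Tendsto (fun k => (μ k).real H - (ν k).real H) atTop (𝓝 0) := by
  -- By `hA` the masses of `Aᶜ` agree in the limit, and they are exactly additive. What remains
  -- concerns the `ℓ²(ℋ)` norms alone.
  have h : Tendsto (fun k => measureVec hp (μ k) - measureVec hp (ν k)) atTop (𝓝 0) := by
    refine tendsto_sub_of_norm_add (C := M) (fun k => (norm_measureVec_le hp _).trans (hμ k))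
      (fun k => (norm_measureVec_le hp _).trans (hν k)) ?_ ?_
    · have := hsub.sub hA
      rw [sub_zero] at this
      exact this.congr fun k => by simp only [pairGauge]; ring
    · refine squeeze_zero (fun k => sub_nonneg.mpr (norm_add_le _ _)) (fun k => ?_) hadd
      have h1 := hs k
      have h2 : (μ k + ν k).real Aᶜ = (μ k).real Aᶜ + (ν k).real Aᶜ := measureReal_add_apply
      rw [pairGauge, measureVec_add, h2] at h1
      simp only [pairGauge]
      linarith
  refine squeeze_zero_norm (fun k => ?_) (tendsto_zero_iff_norm_tendsto_zero.mp h)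
  exact lp.norm_apply_le_norm (by norm_num) (measureVec hp (μ k) - measureVec hp (ν k)) ⟨H, hH⟩

end Pair

/-! ### From a Gruenhage structure to a legitimate system. -/

section System

variable {X : Type*}

/-- The members of the family `𝒰` that contain `x`. -/
def membersAt (𝒰 : Set (Set X)) (x : X) : Set (Set X) := {V | V ∈ 𝒰 ∧ x ∈ V}

/-- The points that lie in at most `m` members of `𝒰`. -/
def levelSet (𝒰 : Set (Set X)) (m : ℕ) : Set X := {x | (membersAt 𝒰 x).encard ≤ m}

/-- The traces on `levelSet 𝒰 m` of the intersections of `m` members of `𝒰`. -/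
def levelFamily (𝒰 : Set (Set X)) (m : ℕ) : Set (Set X) :=
  {H | ∃ F ⊆ 𝒰, F.encard = m ∧ H = levelSet 𝒰 m ∩ ⋂₀ F}

/-- If at most `m` members contain `x`, any `m` of them containing `x` are all of them. Hence
distinct choices of `F` have disjoint traces. -/
theorem eq_membersAt {𝒰 F : Set (Set X)} {m : ℕ} {x : X} (hF : F ⊆ 𝒰) (hFm : F.encard = m)
    (hx : x ∈ levelSet 𝒰 m ∩ ⋂₀ F) : F = membersAt 𝒰 x := by
  refine (Set.finite_of_encard_eq_coe hFm).eq_of_subset_of_encard_le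
    (fun V hV => ⟨hF hV, hx.2 V hV⟩) ?_
  rw [hFm]; exact hx.1

theorem isLegitimatePair_level [TopologicalSpace X] {𝒰 : Set (Set X)} (h𝒰 : ∀ U ∈ 𝒰, IsOpen U)
    (m : ℕ) : IsLegitimatePair (levelSet 𝒰 m) (levelFamily 𝒰 m) where
  isClosed := by
    rw [← isOpen_compl_iff, isOpen_iff_forall_mem_open]
    intro x hx
    -- The intersection of `m + 1` members through `x` is an open neighbourhood missing the level
    -- set.
    have hx' : ((m + 1 : ℕ) : ℕ∞) ≤ (membersAt 𝒰 x).encard := by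
      have h : (m : ℕ∞) < (membersAt 𝒰 x).encard := not_le.mp hx
      rw [Nat.cast_add, Nat.cast_one]
      exact Order.add_one_le_of_lt h
    obtain ⟨F, hF, hFm⟩ := Set.exists_subset_encard_eq hx'
    refine ⟨⋂₀ F, fun y hy hy' => ?_,
      (Set.finite_of_encard_eq_coe hFm).isOpen_sInter fun U hU => h𝒰 U (hF hU).1,
      fun U hU => (hF hU).2⟩
    have h1 : F.encard ≤ (membersAt 𝒰 y).encard :=
      Set.encard_le_encard fun U hU => ⟨(hF hU).1, hy U hU⟩
    have h2 : ((m + 1 : ℕ) : ℕ∞) ≤ (m : ℕ∞) := hFm ▸ h1.trans hy'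
    exact absurd (Nat.cast_le.mp h2) (by omega)
  relOpen := by
    rintro _ ⟨F, hF, hFm, rfl⟩
    exact ⟨⋂₀ F, (Set.finite_of_encard_eq_coe hFm).isOpen_sInter fun U hU => h𝒰 U (hF hU), rfl⟩
  disjoint := by
    rintro _ ⟨F, hF, hFm, rfl⟩ _ ⟨F', hF', hFm', rfl⟩ hne
    refine Set.disjoint_left.mpr fun x hx hx' => hne ?_
    rw [eq_membersAt hF hFm hx, eq_membersAt hF' hFm' hx']

/-- Take `m` to be the number of members through `x`. A point `y` of the resulting trace would have
the same members as `x`. -/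
theorem exists_levelFamily {𝒰 : Set (Set X)} {x y : X} (hx : (membersAt 𝒰 x).Finite)
    (hne : membersAt 𝒰 x ≠ membersAt 𝒰 y) :
    ∃ m, ∃ H ∈ levelFamily 𝒰 m, x ∈ H ∧ y ∉ H := by
  have henc := hx.cast_ncard_eq
  refine ⟨(membersAt 𝒰 x).ncard, _, ⟨membersAt 𝒰 x, fun V hV => hV.1, henc.symm, rfl⟩,
    ⟨henc.ge, fun V hV => hV.2⟩, fun hy => hne ?_⟩
  exact eq_membersAt (fun V hV => hV.1) henc.symm hy

/-- Enlarge a collection of pairs so as to contain the complements, the remainders and the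
intersections of the pairs that it holds. -/
def enlarge (S : Set (Set X × Set (Set X))) : Set (Set X × Set (Set X)) :=
  S ∪ Set.image (fun P : Set X × Set (Set X) => (Set.univ, {P.1ᶜ})) S ∪
    Set.image (fun P : Set X × Set (Set X) => (P.1 \ ⋃₀ P.2, {P.1 \ ⋃₀ P.2})) S ∪
    Set.image2 (fun P Q : Set X × Set (Set X) => (P.1 ∩ Q.1, Set.image2 (· ∩ ·) P.2 Q.2)) S S

theorem countable_enlarge {S : Set (Set X × Set (Set X))} (hS : S.Countable) :
    (enlarge S).Countable :=
  ((hS.union (hS.image _)).union (hS.image _)).union (hS.image2 hS _)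

theorem subset_enlarge (S : Set (Set X × Set (Set X))) : S ⊆ enlarge S := fun _ h =>
  Or.inl (Or.inl (Or.inl h))

variable [TopologicalSpace X]

theorem isClosed_remainder {A : Set X} {ℋ : Set (Set X)} (h : IsLegitimatePair A ℋ) :
    IsClosed (A \ ⋃₀ ℋ) := by
  have : A \ ⋃₀ ℋ = A ∩ ⋂ H : ℋ, ((H : Set X) ∪ Aᶜ)ᶜ := by
    ext t
    simp only [Set.mem_sdiff, Set.mem_sUnion, not_exists, not_and, Set.mem_inter_iff,
      Set.mem_iInter, Set.mem_compl_iff, Set.mem_union, not_or, not_not, Subtype.forall]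
    exact ⟨fun ⟨h1, h2⟩ => ⟨h1, fun H hH => ⟨h2 H hH, h1⟩⟩, fun ⟨h1, h2⟩ =>
      ⟨h1, fun H hH => (h2 H hH).1⟩⟩
  rw [this]
  exact h.isClosed.inter (isClosed_iInter fun H => (h.isOpen_union_compl H).isClosed_compl)

theorem isLegitimatePair_enlarge {S : Set (Set X × Set (Set X))}
    (hS : ∀ P ∈ S, IsLegitimatePair P.1 P.2) : ∀ P ∈ enlarge S, IsLegitimatePair P.1 P.2 := by
  rintro P (((hP | ⟨P, hP, rfl⟩) | ⟨P, hP, rfl⟩) | ⟨P, hP, Q, hQ, rfl⟩)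
  · exact hS P hP
  · refine ⟨isClosed_univ, ?_, ?_⟩
    · rintro _ rfl
      exact ⟨_, (hS P hP).isClosed.isOpen_compl, (Set.univ_inter _).symm⟩
    · rintro _ rfl _ rfl hne
      exact absurd rfl hne
  · refine ⟨isClosed_remainder (hS P hP), ?_, ?_⟩
    · rintro _ rfl
      exact ⟨Set.univ, isOpen_univ, (Set.inter_univ _).symm⟩
    · rintro _ rfl _ rfl hne
      exact absurd rfl hne
  · refine ⟨(hS P hP).isClosed.inter (hS Q hQ).isClosed, ?_, ?_⟩
    · rintro _ ⟨H, hH, H', hH', rfl⟩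
      obtain ⟨O, hO, hHO⟩ := (hS P hP).relOpen H hH
      obtain ⟨O', hO', hHO'⟩ := (hS Q hQ).relOpen H' hH'
      refine ⟨O ∩ O', hO.inter hO', ?_⟩
      dsimp only
      rw [hHO, hHO', Set.inter_inter_inter_comm]
    · rintro _ ⟨H, hH, H', hH', rfl⟩ _ ⟨G, hG, G', hG', rfl⟩ hne
      by_cases h : H = G
      · have h' : H' ≠ G' := fun h' => hne (by rw [h, h'])
        exact ((hS Q hQ).disjoint H' hH' G' hG' h').mono Set.inter_subset_right
          Set.inter_subset_right
      · exact ((hS P hP).disjoint H hH G hG h).mono Set.inter_subset_left Set.inter_subset_left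

/-- A countable collection of legitimate pairs whose members separate points extends to a
legitimate system in which the complements of the closed sets occur over the whole space. -/
theorem exists_isLegitimateSystem {S : Set (Set X × Set (Set X))} (hS : S.Countable)
    (hpair : ∀ P ∈ S, IsLegitimatePair P.1 P.2)
    (hsep : ∀ x y : X, x ≠ y → ∃ P ∈ S, ∃ H ∈ P.2, ∃ z, {x, y} ∩ H = {z}) :
    ∃ (A : ℕ → Set X) (ℋ : ℕ → Set (Set X)), IsLegitimateSystem A ℋ ∧
      (∀ n, IsLegitimatePair (A n) (ℋ n)) ∧
      (∀ n, ∃ m, A m = Set.univ ∧ ℋ m = {(A n)ᶜ}) ∧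
      ∃ m, A m = ∅ := by
  -- The gauge of the pair `(∅, ∅)` is the total mass, and its complement puts the whole space into
  -- the system. Iterating `enlarge` closes the collection under the required operations and keeps
  -- it countable.
  let S₀ : Set (Set X × Set (Set X)) := insert (∅, ∅) S
  let T : ℕ → Set (Set X × Set (Set X)) := fun k => enlarge^[k] S₀
  have hT : ∀ k, T (k + 1) = enlarge (T k) := fun k => Function.iterate_succ_apply' _ _ _
  have hTc : ∀ k, (T k).Countable := by
    intro k
    induction k with
    | zero => exact hS.insert _
    | succ k ih => rw [hT]; exact countable_enlarge ih
  have hTp : ∀ k, ∀ P ∈ T k, IsLegitimatePair P.1 P.2 := by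
    intro k
    induction k with
    | zero =>
      rintro P (rfl | hP)
      · exact ⟨isClosed_empty, fun H hH => hH.elim, fun H hH => hH.elim⟩
      · exact hpair P hP
    | succ k ih => rw [hT]; exact isLegitimatePair_enlarge ih
  have hTm : Monotone T := monotone_nat_of_le_succ fun k => by
    rw [hT]; exact subset_enlarge _
  have hne : (⋃ k, T k).Nonempty := ⟨(∅, ∅), Set.mem_iUnion.mpr ⟨0, Set.mem_insert _ _⟩⟩
  obtain ⟨f, hf⟩ := (Set.countable_iUnion hTc).exists_eq_range hne
  have hmem : ∀ n, ∃ k, f n ∈ T k := fun n =>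
    Set.mem_iUnion.mp (hf ▸ Set.mem_range_self n)
  have hex : ∀ k, ∀ P ∈ T k, ∃ n, f n = P := fun k P hP => by
    have : P ∈ ⋃ k, T k := Set.mem_iUnion.mpr ⟨k, hP⟩
    rwa [hf] at this
  have hfp : ∀ n, IsLegitimatePair (f n).1 (f n).2 := fun n =>
    let ⟨k, hk⟩ := hmem n
    hTp k _ hk
  have hcompl : ∀ k, ∀ P ∈ T k, ∃ m, (f m).1 = Set.univ ∧ (f m).2 = {P.1ᶜ} := fun k P hP => by
    obtain ⟨m, hm⟩ := hex (k + 1) (Set.univ, {P.1ᶜ}) (by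
      rw [hT]; exact Or.inl (Or.inl (Or.inr ⟨_, hP, rfl⟩)))
    exact ⟨m, by rw [hm], by rw [hm]⟩
  refine ⟨fun n => (f n).1, fun n => (f n).2, ⟨fun n => (hfp n).isClosed, fun n => (hfp n).relOpen,
    fun n => (hfp n).disjoint, ?_, ?_, ?_, ?_⟩, hfp, ?_, ?_⟩
  · intro x y hxy
    obtain ⟨P, hP, H, hH, hz⟩ := hsep x y hxy
    obtain ⟨n, rfl⟩ := hex 0 P (Set.mem_insert_of_mem _ hP)
    exact ⟨H, Set.mem_iUnion.mpr ⟨n, hH⟩, hz⟩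
  · intro H hH H' hH'
    obtain ⟨n, hn⟩ := Set.mem_iUnion.mp hH
    obtain ⟨n', hn'⟩ := Set.mem_iUnion.mp hH'
    obtain ⟨k, hk⟩ := hmem n
    obtain ⟨k', hk'⟩ := hmem n'
    obtain ⟨m, hm⟩ := hex (max k k' + 1)
      ((f n).1 ∩ (f n').1, Set.image2 (· ∩ ·) (f n).2 (f n').2) (by
        rw [hT]
        exact Or.inr ⟨_, hTm (le_max_left _ _) hk, _, hTm (le_max_right _ _) hk', rfl⟩)
    refine Set.mem_iUnion.mpr ⟨m, ?_⟩
    rw [hm]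
    exact ⟨H, hn, H', hn', rfl⟩
  · intro n
    obtain ⟨k, hk⟩ := hmem n
    obtain ⟨m, -, hm⟩ := hcompl k _ hk
    exact Set.mem_iUnion.mpr ⟨m, hm ▸ rfl⟩
  · intro n
    obtain ⟨k, hk⟩ := hmem n
    obtain ⟨m, hm⟩ := hex (k + 1) ((f n).1 \ ⋃₀ (f n).2, {(f n).1 \ ⋃₀ (f n).2}) (by
      rw [hT]; exact Or.inl (Or.inr ⟨_, hk, rfl⟩))
    refine Set.mem_iUnion.mpr ⟨m, ?_⟩
    rw [hm]
    rfl
  · intro n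
    obtain ⟨k, hk⟩ := hmem n
    exact hcompl k _ hk
  · obtain ⟨m, hm⟩ := hex 0 (∅, ∅) (Set.mem_insert _ _)
    exact ⟨m, congrArg Prod.fst hm⟩

theorem IsGruenhage.exists_isLegitimateSystem (h : IsGruenhage X) :
    ∃ (A : ℕ → Set X) (ℋ : ℕ → Set (Set X)), IsLegitimateSystem A ℋ ∧
      (∀ n, IsLegitimatePair (A n) (ℋ n)) ∧
      (∀ n, ∃ m, A m = Set.univ ∧ ℋ m = {(A n)ᶜ}) ∧
      ∃ m, A m = ∅ := by
  obtain ⟨𝒰, hopen, hsep⟩ := h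
  refine GruenhageRenorming.exists_isLegitimateSystem
    (S := Set.range fun i : ℕ × ℕ => (levelSet (𝒰 i.1) i.2, levelFamily (𝒰 i.1) i.2))
    (Set.countable_range _) ?_ ?_
  · rintro _ ⟨i, rfl⟩
    exact isLegitimatePair_level (hopen i.1) i.2
  · intro x y hxy
    obtain ⟨n, U, hU, ⟨z, hz⟩, hfin⟩ := hsep x y hxy
    have hne : membersAt (𝒰 n) x ≠ membersAt (𝒰 n) y := by
      intro heq
      have h1 : x ∈ U ↔ y ∈ U := by
        have := Set.ext_iff.mp heq U
        simpa [membersAt, hU] using this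
      by_cases hx : x ∈ U
      · have e1 : x = z := (hz ▸ (⟨hx, by simp⟩ : x ∈ U ∩ {x, y}) : x ∈ ({z} : Set X))
        have e2 : y = z := (hz ▸ (⟨h1.mp hx, by simp⟩ : y ∈ U ∩ {x, y}) : y ∈ ({z} : Set X))
        exact hxy (e1.trans e2.symm)
      · have hzU : z ∈ U ∩ {x, y} := hz ▸ rfl
        rcases hzU.2 with rfl | rfl
        · exact hx hzU.1
        · exact hx (h1.mpr hzU.1)
    rcases hfin with hfin | hfin
    · obtain ⟨m, H, hH, hxH, hyH⟩ := exists_levelFamily hfin hne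
      refine ⟨_, ⟨(n, m), rfl⟩, H, hH, x, ?_⟩
      ext t
      simp only [Set.mem_inter_iff, Set.mem_insert_iff, Set.mem_singleton_iff]
      constructor
      · rintro ⟨rfl | rfl, h⟩
        · rfl
        · exact absurd h hyH
      · rintro rfl
        exact ⟨Or.inl rfl, hxH⟩
    · obtain ⟨m, H, hH, hyH, hxH⟩ := exists_levelFamily hfin hne.symm
      refine ⟨_, ⟨(n, m), rfl⟩, H, hH, y, ?_⟩
      ext t
      simp only [Set.mem_inter_iff, Set.mem_insert_iff, Set.mem_singleton_iff]
      constructor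
      · rintro ⟨rfl | rfl, h⟩
        · exact absurd h hxH
        · rfl
      · rintro rfl
        exact ⟨Or.inr rfl, hyH⟩

end System

/-! ### The indicators span a 1-norming subspace. -/

section Norming

/-- The algebra of functions generated by the indicators of the members of `𝒮`. -/
def indicatorAlgebra {X : Type*} (𝒮 : Set (Set X)) : Subalgebra ℝ (X → ℝ) :=
  Algebra.adjoin ℝ {s | ∃ H ∈ 𝒮, s = H.indicator 1}

/-- Stability under intersections makes the indicators a multiplicative monoid, so products add
nothing to their linear span. -/
theorem mem_span_of_mem_indicatorAlgebra {X : Type*} {𝒮 : Set (Set X)}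
    (h_inter : ∀ H ∈ 𝒮, ∀ H' ∈ 𝒮, H ∩ H' ∈ 𝒮) (huniv : Set.univ ∈ 𝒮) {s : X → ℝ}
    (hs : s ∈ indicatorAlgebra 𝒮) : s ∈ Submodule.span ℝ {s | ∃ H ∈ 𝒮, s = H.indicator 1} := by
  let M : Submonoid (X → ℝ) :=
    { carrier := {s | ∃ H ∈ 𝒮, s = H.indicator 1}
      one_mem' := ⟨Set.univ, huniv, by simp⟩
      mul_mem' := by
        rintro _ _ ⟨H, hH, rfl⟩ ⟨H', hH', rfl⟩
        exact ⟨H ∩ H', h_inter H hH H' hH', by rw [Set.inter_indicator_one]⟩ }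
  have hM : (Submonoid.closure {s : X → ℝ | ∃ H ∈ 𝒮, s = H.indicator 1} : Set (X → ℝ)) ⊆
      (Submodule.span ℝ {s : X → ℝ | ∃ H ∈ 𝒮, s = H.indicator 1} : Set (X → ℝ)) := by
    intro s hs
    have hsM : s ∈ M := (Submonoid.closure_le (S := M)).mpr (fun s hs => hs) hs
    exact Submodule.subset_span hsM
  rw [← Subalgebra.mem_toSubmodule, indicatorAlgebra, Algebra.adjoin_eq_span_of_subset ℝ hM] at hs
  exact hs

theorem finite_range_of_mem_indicatorAlgebra {X : Type*} {𝒮 : Set (Set X)} {s : X → ℝ}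
    (hs : s ∈ indicatorAlgebra 𝒮) : (Set.range s).Finite := by
  refine Algebra.adjoin_induction ?_ ?_ ?_ ?_ hs
  · rintro _ ⟨H, -, rfl⟩
    refine (Set.toFinite {(1 : ℝ), 0}).subset ?_
    rintro _ ⟨t, rfl⟩
    by_cases ht : t ∈ H <;> simp [ht]
  · intro r
    refine (Set.finite_singleton r).subset ?_
    rintro _ ⟨t, rfl⟩
    rfl
  · intro f g _ _ hf hg
    refine (hf.image2 (· + ·) hg).subset ?_
    rintro _ ⟨t, rfl⟩
    exact ⟨_, ⟨t, rfl⟩, _, ⟨t, rfl⟩, rfl⟩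
  · intro f g _ _ hf hg
    refine (hf.image2 (· * ·) hg).subset ?_
    rintro _ ⟨t, rfl⟩
    exact ⟨_, ⟨t, rfl⟩, _, ⟨t, rfl⟩, rfl⟩

/-- The algebra generated by indicators is stable under composition with arbitrary functions. -/
theorem comp_mem_indicatorAlgebra {X : Type*} {𝒮 : Set (Set X)} {s : X → ℝ}
    (hs : s ∈ indicatorAlgebra 𝒮) (θ : ℝ → ℝ) : θ ∘ s ∈ indicatorAlgebra 𝒮 := by
  set R := (finite_range_of_mem_indicatorAlgebra hs).toFinset with hR
  -- On the finitely many values of `s`, `θ` coincides with a polynomial.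
  let P : Polynomial ℝ := Lagrange.interpolate R id θ
  have hP : Polynomial.aeval s P = θ ∘ s := by
    funext t
    rw [Polynomial.aeval_fn_apply]
    exact Lagrange.eval_interpolate_at_node θ (Set.injOn_id _) (i := s t) (by simp [hR])
  rw [← hP]
  exact Algebra.adjoin_le (Set.singleton_subset_iff.mpr hs)
    (Polynomial.aeval_mem_adjoin_singleton ℝ s)

variable {K : Type*} [TopologicalSpace K] [CompactSpace K] [T2Space K] [MeasurableSpace K]
  [BorelSpace K]

theorem exists_mem_span_indicatorFunctional {𝒮 : Set (Set K)} (hmeas : ∀ H ∈ 𝒮, MeasurableSet H)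
    {s : K → ℝ} (hs : s ∈ Submodule.span ℝ {s : K → ℝ | ∃ H ∈ 𝒮, s = H.indicator 1}) :
    (∀ (μ : Measure K) [IsFiniteMeasure μ], Integrable s μ) ∧
    ∃ ξ ∈ Submodule.span ℝ {ξ : Dual (Dual C(K, ℝ)) | ∃ H ∈ 𝒮, IsIndicatorFunctional H ξ},
      ∀ φ, ξ φ = (∫ t, s t ∂posMeasure φ) - ∫ t, s t ∂posMeasure (-φ) := by
  induction hs using Submodule.span_induction with
  | mem s hs =>
    obtain ⟨H, hH, rfl⟩ := hs
    refine ⟨fun μ _ => integrable_indicator_one' μ (hmeas H hH), indicatorFunctional H,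
      Submodule.subset_span ⟨H, hH, isIndicatorFunctional_iff.mpr rfl⟩, fun φ => ?_⟩
    rw [integral_indicator_one (hmeas H hH), integral_indicator_one (hmeas H hH),
      indicatorFunctional_apply]
  | zero => exact ⟨fun μ _ => integrable_zero _ _ _, 0, Submodule.zero_mem _, fun φ => by simp⟩
  | add s s' _ _ h h' =>
    obtain ⟨hi, ξ, hξ, hξs⟩ := h
    obtain ⟨hi', ξ', hξ', hξs'⟩ := h'
    refine ⟨fun μ _ => (hi μ).add (hi' μ), ξ + ξ', Submodule.add_mem _ hξ hξ', fun φ => ?_⟩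
    simp only [Pi.add_apply]
    rw [integral_add (hi _) (hi' _), integral_add (hi _) (hi' _), add_apply, hξs, hξs']
    ring
  | smul a s _ h =>
    obtain ⟨hi, ξ, hξ, hξs⟩ := h
    refine ⟨fun μ _ => (hi μ).smul a, a • ξ, Submodule.smul_mem _ a hξ, fun φ => ?_⟩
    simp only [Pi.smul_apply]
    rw [integral_smul, integral_smul, smul_apply, hξs, smul_sub]

omit [CompactSpace K] in
/-- Up to small measure, the members of a legitimate pair are relatively clopen in a compact
set. -/
theorem exists_isCompact_forall_clopen {A : Set K} {ℋ : Set (Set K)} (hp : IsLegitimatePair A ℋ)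
    (μ : Measure K) [IsFiniteMeasure μ] [μ.Regular] {ε : ENNReal} (hε : ε ≠ 0) :
    ∃ E, IsCompact E ∧ μ Eᶜ ≤ ε ∧ ∀ H ∈ ℋ, IsClosed (E ∩ H) ∧ IsClosed (E \ H) := by
  have hε3 : ε / 3 ≠ 0 := (ENNReal.div_pos hε (by norm_num)).ne'
  have hsub : ⋃₀ ℋ ⊆ A := Set.sUnion_subset fun H hH => hp.subset ⟨H, hH⟩
  have hrem : MeasurableSet (A \ ⋃₀ ℋ) := (isClosed_remainder hp).measurableSet
  have hU : MeasurableSet (⋃₀ ℋ) := by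
    have := hp.isClosed.measurableSet.diff hrem
    rwa [sdiff_sdiff_right_self, inf_eq_right.mpr hsub] at this
  -- The space splits into `⋃₀ ℋ`, `Aᶜ` and the remainder, each exhausted by a compact set. Only `C`
  -- meets members of `ℋ`. They partition it into relatively open, hence relatively clopen, pieces.
  obtain ⟨C, hCU, hC, hμC⟩ := hU.exists_isCompact_sdiff_lt (measure_ne_top μ _) hε3
  obtain ⟨C₀, hC₀A, hC₀, hμC₀⟩ :=
    hp.isClosed.measurableSet.compl.exists_isCompact_sdiff_lt (measure_ne_top μ _) hε3
  obtain ⟨C₁, hC₁A, hC₁, hμC₁⟩ := hrem.exists_isCompact_sdiff_lt (measure_ne_top μ _) hε3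
  refine ⟨C ∪ C₀ ∪ C₁, (hC.union hC₀).union hC₁, ?_, fun H hH => ⟨?_, ?_⟩⟩
  · have hcov : (C ∪ C₀ ∪ C₁)ᶜ ⊆ (⋃₀ ℋ \ C) ∪ (Aᶜ \ C₀) ∪ ((A \ ⋃₀ ℋ) \ C₁) := by
      intro t ht
      simp only [Set.mem_compl_iff, Set.mem_union, not_or] at ht
      by_cases htA : t ∈ A
      · by_cases htU : t ∈ ⋃₀ ℋ
        · exact Or.inl (Or.inl ⟨htU, ht.1.1⟩)
        · exact Or.inr ⟨⟨htA, htU⟩, ht.2⟩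
      · exact Or.inl (Or.inr ⟨htA, ht.1.2⟩)
    calc μ (C ∪ C₀ ∪ C₁)ᶜ ≤ μ ((⋃₀ ℋ \ C) ∪ (Aᶜ \ C₀) ∪ ((A \ ⋃₀ ℋ) \ C₁)) := measure_mono hcov
      _ ≤ μ (⋃₀ ℋ \ C) + μ (Aᶜ \ C₀) + μ ((A \ ⋃₀ ℋ) \ C₁) :=
        (measure_union_le _ _).trans (add_le_add (measure_union_le _ _) le_rfl)
      _ ≤ ε / 3 + ε / 3 + ε / 3 := add_le_add (add_le_add hμC.le hμC₀.le) hμC₁.le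
      _ = ε := ENNReal.add_thirds ε
  · have : (C ∪ C₀ ∪ C₁) ∩ H = C ∩ ⋂ H' : {H' : ℋ // (H' : Set K) ≠ H}, ((H' : Set K) ∪ Aᶜ)ᶜ := by
      ext t
      simp only [Set.mem_inter_iff, Set.mem_union, Set.mem_iInter, Set.mem_compl_iff, not_or,
        not_not]
      constructor
      · rintro ⟨(ht | ht) | ht, htH⟩
        · refine ⟨ht, fun H' => ⟨fun htH' => ?_, hsub (hCU ht)⟩⟩
          exact (hp.disjoint H' H'.1.2 H hH H'.2).le_bot ⟨htH', htH⟩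
        · exact absurd (hp.subset ⟨H, hH⟩ htH) (hC₀A ht)
        · exact absurd ⟨H, hH, htH⟩ (hC₁A ht).2
      · rintro ⟨ht, h⟩
        refine ⟨Or.inl (Or.inl ht), ?_⟩
        obtain ⟨H', hH', htH'⟩ := hCU ht
        by_cases heq : H' = H
        · exact heq ▸ htH'
        · exact absurd htH' (h ⟨⟨H', hH'⟩, heq⟩).1
    rw [this]
    exact hC.isClosed.inter
      (isClosed_iInter fun H' => (hp.isOpen_union_compl H'.1).isClosed_compl)
  · have : (C ∪ C₀ ∪ C₁) \ H = C \ (H ∪ Aᶜ) ∪ C₀ ∪ C₁ := by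
      ext t
      simp only [Set.mem_sdiff, Set.mem_union, Set.mem_compl_iff, not_or, not_not]
      constructor
      · rintro ⟨(ht | ht) | ht, htH⟩
        · exact Or.inl (Or.inl ⟨ht, htH, hsub (hCU ht)⟩)
        · exact Or.inl (Or.inr ht)
        · exact Or.inr ht
      · rintro ((⟨ht, htH, -⟩ | ht) | ht)
        · exact ⟨Or.inl (Or.inl ht), htH⟩
        · exact ⟨Or.inl (Or.inr ht), fun htH => hC₀A ht (hp.subset ⟨H, hH⟩ htH)⟩
        · exact ⟨Or.inr ht, fun htH => (hC₁A ht).2 ⟨H, hH, htH⟩⟩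
    rw [this]
    exact ((hC.isClosed.inter (hp.isOpen_union_compl ⟨H, hH⟩).isClosed_compl).union
      hC₀.isClosed).union hC₁.isClosed

omit [MeasurableSpace K] [BorelSpace K] [T2Space K] [CompactSpace K] in
/-- On a compact set on which the members of a separating family are relatively clopen,
continuous functions are uniformly approximable by functions in the indicator algebra. -/
theorem exists_mem_indicatorAlgebra_near {𝒮 : Set (Set K)} (hsep : SeparatesPoints 𝒮) {L : Set K}
    (hL : IsCompact L) (hclopen : ∀ H ∈ 𝒮, IsClosed (L ∩ H) ∧ IsClosed (L \ H)) (f : C(K, ℝ))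
    {δ : ℝ} (hδ : 0 < δ) : ∃ s ∈ indicatorAlgebra 𝒮, ∀ t ∈ L, |s t - f t| < δ := by
  have : CompactSpace L := isCompact_iff_compactSpace.mp hL
  let 𝒜 : Subalgebra ℝ C(L, ℝ) :=
    Algebra.adjoin ℝ {g | ∃ H ∈ 𝒮, ∀ t : L, g t = H.indicator 1 (t : K)}
  have hcont : ∀ H ∈ 𝒮, ∃ g : C(L, ℝ), ∀ t : L, g t = H.indicator 1 (t : K) := by
    intro H hH
    have hcl : IsClopen (Subtype.val ⁻¹' H : Set L) := by
      refine ⟨?_, ?_⟩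
      · have := (hclopen H hH).1.preimage (continuous_subtype_val (p := (· ∈ L)))
        convert this using 1
        ext t; simp
      · rw [← isClosed_compl_iff]
        have := (hclopen H hH).2.preimage (continuous_subtype_val (p := (· ∈ L)))
        convert this using 1
        ext t; simp
    exact ⟨⟨_, hcl.continuous_indicator (continuous_const (y := (1 : ℝ)))⟩, fun t => rfl⟩
  have hrep : ∀ g ∈ 𝒜, ∃ s ∈ indicatorAlgebra 𝒮, ∀ t : L, g t = s t := by
    intro g hg
    refine Algebra.adjoin_induction ?_ ?_ ?_ ?_ hg
    · rintro g ⟨H, hH, hgH⟩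
      exact ⟨H.indicator 1, Algebra.subset_adjoin ⟨H, hH, rfl⟩, hgH⟩
    · intro r
      exact ⟨algebraMap ℝ _ r, Subalgebra.algebraMap_mem _ r, fun t => rfl⟩
    · rintro g g' - - ⟨s, hs, h⟩ ⟨s', hs', h'⟩
      exact ⟨s + s', add_mem hs hs', fun t => by simp [h, h']⟩
    · rintro g g' - - ⟨s, hs, h⟩ ⟨s', hs', h'⟩
      exact ⟨s * s', mul_mem hs hs', fun t => by simp [h, h']⟩
  have h𝒜 : 𝒜.SeparatesPoints := by
    intro x y hxy
    obtain ⟨H, hH, z, hz⟩ := hsep x y (fun h => hxy (Subtype.ext h))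
    obtain ⟨g, hg⟩ := hcont H hH
    refine ⟨g, ⟨g, Algebra.subset_adjoin ⟨H, hH, hg⟩, rfl⟩, ?_⟩
    rw [hg, hg]
    have hxz : (x : K) ∈ H → (x : K) = z := fun h =>
      (hz ▸ (⟨by simp, h⟩ : (x : K) ∈ ({(x : K), (y : K)} : Set K) ∩ H) : (x : K) ∈ ({z} : Set K))
    have hyz : (y : K) ∈ H → (y : K) = z := fun h =>
      (hz ▸ (⟨by simp, h⟩ : (y : K) ∈ ({(x : K), (y : K)} : Set K) ∩ H) : (y : K) ∈ ({z} : Set K))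
    have hzm : z ∈ ({(x : K), (y : K)} : Set K) ∩ H := hz ▸ rfl
    by_cases hx : (x : K) ∈ H
    · have hy : (y : K) ∉ H := fun hy => hxy (Subtype.ext ((hxz hx).trans (hyz hy).symm))
      simp [hx, hy]
    · have hy : (y : K) ∈ H := by
        rcases hzm.1 with h | h
        · exact absurd (h ▸ hzm.2) hx
        · exact h ▸ hzm.2
      simp [hx, hy]
  obtain ⟨g, hg⟩ := ContinuousMap.exists_mem_subalgebra_near_continuous_of_separatesPoints 𝒜 h𝒜
    (fun t : L => f t) (by fun_prop) δ hδ
  obtain ⟨s, hs, hgs⟩ := hrep g g.2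
  refine ⟨s, hs, fun t ht => ?_⟩
  have := hg ⟨t, ht⟩
  rwa [hgs ⟨t, ht⟩] at this

variable {A : ℕ → Set K} {ℋ : ℕ → Set (Set K)}

theorem isOneNorming_indicatorSpan (hsys : IsLegitimateSystem A ℋ)
    (hp : ∀ n, IsLegitimatePair (A n) (ℋ n)) {n₀ : ℕ} (hn₀ : A n₀ = ∅) :
    IsOneNorming (indicatorSpan (⋃ n, ℋ n)) := by
  have huniv : Set.univ ∈ ⋃ n, ℋ n := by
    simpa only [hn₀, Set.compl_empty] using hsys.compl_mem n₀
  intro φ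
  refine ⟨?_, fun b hb => ?_⟩
  · rintro _ ⟨ξ, -, hξ, rfl⟩
    exact (le_abs_self _).trans ((ξ.le_opNorm φ).trans
      (mul_le_of_le_one_left (norm_nonneg _) hξ))
  rw [← varMeasure_univ φ]
  by_contra! hlt
  have h1 : ∫ t, (1 : C(K, ℝ)) t ∂varMeasure φ = (varMeasure φ).real Set.univ := by simp
  rw [← h1] at hlt
  obtain ⟨f, hf, hbf⟩ := exists_lt_of_lt_integral_varMeasure φ (f := 1) zero_le_one hlt
  have hf1 : ∀ t, |f t| ≤ 1 := hf
  set M := (varMeasure φ).real Set.univ with hM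
  have hM0 : 0 ≤ M := measureReal_nonneg
  -- The final error is `δ` on `L`, of mass at most `M`, plus `2` off `L`, of mass at most `δ`: in
  -- total `δ * (M + 2)`.
  set δ := (φ f - b) / (2 * (M + 2)) with hδ
  have hδ0 : 0 < δ := div_pos (by linarith) (by linarith)
  have hδM : δ * (M + 2) < φ f - b := by
    rw [hδ, div_mul_eq_mul_div, div_lt_iff₀ (by linarith)]
    nlinarith
  -- Summable errors allow one compact set `L` to serve all pairs simultaneously.
  obtain ⟨ε, hε0, hεs⟩ := ENNReal.exists_pos_sum_of_countable'
    (ε := ENNReal.ofReal δ) (by simpa using hδ0) ℕ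
  have hE := fun n => exists_isCompact_forall_clopen (hp n) (varMeasure φ) (hε0 n).ne'
  choose E hEc hEμ hEcl using hE
  set L := ⋂ n, E n with hLdef
  have hL : IsCompact L := (isClosed_iInter fun n => (hEc n).isClosed).isCompact
  have hLμ : (varMeasure φ).real Lᶜ ≤ δ := by
    refine ENNReal.toReal_le_of_le_ofReal hδ0.le ?_
    rw [hLdef, Set.compl_iInter]
    exact (measure_iUnion_le _).trans ((ENNReal.tsum_le_tsum hEμ).trans hεs.le)
  have hclopen : ∀ H ∈ ⋃ n, ℋ n, IsClosed (L ∩ H) ∧ IsClosed (L \ H) := by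
    intro H hH
    obtain ⟨n, hn⟩ := Set.mem_iUnion.mp hH
    have hLE : L ⊆ E n := Set.iInter_subset _ n
    constructor
    · have : L ∩ H = L ∩ (E n ∩ H) := by
        rw [← Set.inter_assoc, Set.inter_eq_left.mpr hLE]
      rw [this]; exact hL.isClosed.inter (hEcl n H hn).1
    · have : L \ H = L ∩ (E n \ H) := by
        ext t
        exact ⟨fun h => ⟨h.1, hLE h.1, h.2⟩, fun h => ⟨h.1, h.2.2⟩⟩
      rw [this]; exact hL.isClosed.inter (hEcl n H hn).2
  obtain ⟨s₀, hs₀, hs₀f⟩ := exists_mem_indicatorAlgebra_near hsys.separates hL hclopen f hδ0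
  -- Nothing bounds `s₀` off `L`. Truncation stays in the algebra, gives `‖ξ‖ ≤ 1`, and does not
  -- spoil the approximation of `f`, since `|f| ≤ 1`.
  let s : K → ℝ := (fun r => max (-1) (min 1 r)) ∘ s₀
  have hs : s ∈ indicatorAlgebra (⋃ n, ℋ n) := comp_mem_indicatorAlgebra hs₀ _
  have hs1 : ∀ t, |s t| ≤ 1 := fun t =>
    abs_le.mpr ⟨le_max_left _ _, max_le (by norm_num) (min_le_left _ _)⟩
  have hsf : ∀ t ∈ L, |s t - f t| ≤ δ := by
    intro t ht
    have h2 := abs_lt.mp (hs₀f t ht)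
    have h3 := abs_le.mp (hf1 t)
    rw [abs_le]
    constructor
    · have : f t - δ ≤ s t := le_max_of_le_right (le_min (by linarith) (by linarith))
      linarith
    · have : s t ≤ f t + δ := max_le (by linarith) (min_le_of_right_le (by linarith))
      linarith
  have hmeas : ∀ H ∈ ⋃ n, ℋ n, MeasurableSet H := fun H hH => by
    obtain ⟨n, hn⟩ := Set.mem_iUnion.mp hH
    exact (hp n).measurableSet ⟨H, hn⟩
  obtain ⟨hs_int, ξ, hξ, hξs⟩ := exists_mem_span_indicatorFunctional hmeas
    (mem_span_of_mem_indicatorAlgebra hsys.inter_mem huniv hs)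
  have hξ1 : ‖ξ‖ ≤ 1 := by
    refine ξ.opNorm_le_bound zero_le_one fun ψ => ?_
    rw [hξs, one_mul, ← varMeasure_univ ψ, varMeasure_real_apply]
    have key : ∀ (μ : Measure K) [IsFiniteMeasure μ], ‖∫ t, s t ∂μ‖ ≤ μ.real Set.univ := by
      intro μ _
      simpa using norm_integral_le_of_norm_le_const (μ := μ) (f := s) (C := 1)
        (ae_of_all _ fun t => hs1 t)
    exact (norm_sub_le _ _).trans (add_le_add (key _) (key _))
  have hle : ξ φ ≤ b := hb ⟨ξ, Submodule.le_topologicalClosure _ hξ, hξ1, rfl⟩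
  have hd : ∀ (μ : Measure K) [IsFiniteMeasure μ], Integrable (fun t => |f t - s t|) μ := by
    intro μ _
    exact ((integrable_continuousMap f μ).sub (hs_int μ)).abs
  have hbound : ∫ t, |f t - s t| ∂varMeasure φ ≤ δ * (M + 2) := by
    have hLc : MeasurableSet Lᶜ := hL.isClosed.measurableSet.compl
    have hi := integrable_indicator_one' (varMeasure φ) hLc
    calc ∫ t, |f t - s t| ∂varMeasure φ
        ≤ ∫ t, (δ + 2 * Lᶜ.indicator 1 t) ∂varMeasure φ := by
          refine integral_mono (hd _) ((integrable_const δ).add (hi.const_mul 2)) fun t => ?_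
          by_cases ht : t ∈ L
          · have : t ∉ Lᶜ := fun h => h ht
            simp only [Set.indicator_of_notMem this, mul_zero, add_zero]
            rw [abs_sub_comm]; exact hsf t ht
          · have : t ∈ Lᶜ := ht
            simp only [Set.indicator_of_mem this, Pi.one_apply, mul_one]
            have h2 := abs_le.mp (hf1 t)
            have h3 := abs_le.mp (hs1 t)
            rw [abs_le]; constructor <;> linarith
      _ = δ * M + 2 * (varMeasure φ).real Lᶜ := by
          rw [integral_add (integrable_const δ) (hi.const_mul 2), integral_const_mul,
            integral_indicator_one hLc, integral_const, smul_eq_mul, mul_comm]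
      _ ≤ δ * (M + 2) := by linarith
  have hv : ∫ t, |f t - s t| ∂varMeasure φ =
      (∫ t, |f t - s t| ∂posMeasure φ) + ∫ t, |f t - s t| ∂posMeasure (-φ) :=
    integral_add_measure (hd _) (hd _)
  have hdiff : φ f - ξ φ ≤ ∫ t, |f t - s t| ∂varMeasure φ := by
    have e1 : (∫ t, f t ∂posMeasure φ) - ∫ t, s t ∂posMeasure φ ≤
        ∫ t, |f t - s t| ∂posMeasure φ := by
      rw [← integral_sub (integrable_continuousMap f _) (hs_int _)]
      exact integral_mono ((integrable_continuousMap f _).sub (hs_int _)) (hd _)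
        fun t => le_abs_self _
    have e2 : (∫ t, s t ∂posMeasure (-φ)) - ∫ t, f t ∂posMeasure (-φ) ≤
        ∫ t, |f t - s t| ∂posMeasure (-φ) := by
      rw [← integral_sub (hs_int _) (integrable_continuousMap f _)]
      refine integral_mono ((hs_int _).sub (integrable_continuousMap f _)) (hd _) fun t => ?_
      simp only
      rw [abs_sub_comm]; exact le_abs_self _
    rw [isRepresentedBy_posMeasure φ f, hξs, hv]
    linarith
  linarith

end Norming

/-! ### The two norms and their rotundity. -/

section Renorming

theorem tendsto_of_mem_closedSpan {E : Type*} [NormedAddCommGroup E] [NormedSpace ℝ E]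
    {S : Set (Dual E)} {z : ℕ → E} {C : ℝ} (hz : ∀ n, ‖z n‖ ≤ C)
    (hS : ∀ f ∈ S, Tendsto (fun n => f (z n)) atTop (𝓝 0)) {f : Dual E} (hf : f ∈ closedSpan S) :
    Tendsto (fun n => f (z n)) atTop (𝓝 0) := by
  have hspan : ∀ g ∈ Submodule.span ℝ S, Tendsto (fun n => g (z n)) atTop (𝓝 0) := by
    intro g hg
    induction hg using Submodule.span_induction with
    | mem g hg => exact hS g hg
    | zero => simp
    | add g g' _ _ h h' => simpa using h.add h'
    | smul a g _ h => simpa using h.const_mul a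
  have hC : 0 ≤ C := (norm_nonneg _).trans (hz 0)
  rw [Metric.tendsto_atTop]
  intro ε hε
  obtain ⟨g, hg, hfg⟩ := Metric.mem_closure_iff.mp hf (ε / (2 * (C + 1))) (by positivity)
  obtain ⟨N, hN⟩ := Metric.tendsto_atTop.mp (hspan g hg) (ε / 2) (by positivity)
  refine ⟨N, fun n hn => ?_⟩
  have h1 := hN n hn
  rw [dist_zero_right] at h1 ⊢
  rw [dist_eq_norm] at hfg
  have h2 : ‖(f - g) (z n)‖ ≤ ε / (2 * (C + 1)) * C :=
    ((f - g).le_opNorm _).trans (mul_le_mul hfg.le (hz n) (norm_nonneg _) (by positivity))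
  have h3 : ε / (2 * (C + 1)) * C ≤ ε / 2 := by
    rw [div_mul_eq_mul_div, div_le_div_iff₀ (by positivity) (by positivity)]
    nlinarith
  have h4 : f (z n) = (f - g) (z n) + g (z n) := by simp
  rw [h4]
  exact (norm_add_le _ _).trans_lt (by linarith)

variable {K : Type*} [TopologicalSpace K] [MeasurableSpace K]
  [BorelSpace K] {A : ℕ → Set K} {ℋ : ℕ → Set (Set K)}

/-- For the pair `(K, {(A n)ᶜ})` the complement term is the mass of `∅`, so its hypothesis on
complements is trivial. Its conclusion is the hypothesis needed for the pair `n`. -/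
theorem tendsto_measureReal_of_pairGauge (hp : ∀ n, IsLegitimatePair (A n) (ℋ n))
    (hcompl : ∀ n, ∃ m, A m = Set.univ ∧ ℋ m = {(A n)ᶜ}) {μ ν : ℕ → Measure K}
    [∀ k, IsFiniteMeasure (μ k)] [∀ k, IsFiniteMeasure (ν k)] {M : ℝ}
    (hμ : ∀ k, (μ k).real Set.univ ≤ M) (hν : ∀ k, (ν k).real Set.univ ≤ M) {s : ℕ → ℕ → ℝ}
    (hs : ∀ n k, s n k ≤ pairGauge (hp n) (μ k + ν k))
    (hsub : ∀ n, Tendsto (fun k => pairGauge (hp n) (μ k) - pairGauge (hp n) (ν k)) atTop (𝓝 0))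
    (hadd : ∀ n, Tendsto (fun k => pairGauge (hp n) (μ k) + pairGauge (hp n) (ν k) - s n k) atTop
      (𝓝 0)) {H : Set K} (hH : H ∈ ⋃ n, ℋ n) :
    Tendsto (fun k => (μ k).real H - (ν k).real H) atTop (𝓝 0) := by
  obtain ⟨n, hn⟩ := Set.mem_iUnion.mp hH
  obtain ⟨m, hm, hm'⟩ := hcompl n
  have hR : Tendsto (fun k => (μ k).real (A n)ᶜ - (ν k).real (A n)ᶜ) atTop (𝓝 0) :=
    tendsto_measureReal_sub (hp m) hμ hν (hs m) (by simp [hm]) (hsub m) (hadd m) (by simp [hm'])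
  exact tendsto_measureReal_sub (hp n) hμ hν (hs n) hR (hsub n) (hadd n) hn

/-- This pair makes the total mass one of the gauges. It yields the equivalence of both norms and
the norm additivity behind strict convexity. -/
theorem pairGauge_of_eq_empty {A : Set K} {ℋ : Set (Set K)} (hp : IsLegitimatePair A ℋ)
    (hA : A = ∅) (μ : Measure K) [IsFiniteMeasure μ] : pairGauge hp μ = μ.real Set.univ := by
  have h : measureVec hp μ = 0 := by
    ext H
    have hH : (H : Set K) = ∅ := Set.subset_empty_iff.mp (hA ▸ hp.subset H)
    change μ.real (H : Set K) = 0
    rw [hH, measureReal_empty]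
  rw [pairGauge, h, norm_zero, add_zero, hA, Set.compl_empty]

variable [CompactSpace K] [T2Space K]

/-- The dual norm built from the positive and the negative parts of measures. -/
noncomputable def posNorm (hp : ∀ n, IsLegitimatePair (A n) (ℋ n)) : Seminorm ℝ (Dual C(K, ℝ)) :=
  supportNorm fun n => isUnitSubset_posSet (hp n)

/-- The dual lattice norm built from the variations of measures. -/
noncomputable def absNorm (hp : ∀ n, IsLegitimatePair (A n) (ℋ n)) : Seminorm ℝ (Dual C(K, ℝ)) :=
  supportNorm fun n => isUnitSubset_absSet (hp n)

theorem isEquivalentNorm_posNorm (hp : ∀ n, IsLegitimatePair (A n) (ℋ n)) {n₀ : ℕ}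
    (hn₀ : A n₀ = ∅) : IsEquivalentNorm (posNorm hp) := by
  refine isEquivalentNorm_supportNorm _ (n₀ := n₀) fun φ => ?_
  rw [supportFn_posSet (hp n₀), supportFn_posSet (hp n₀), pairGauge_of_eq_empty _ hn₀,
    pairGauge_of_eq_empty _ hn₀, ← varMeasure_univ, varMeasure_real_apply]

theorem isEquivalentNorm_absNorm (hp : ∀ n, IsLegitimatePair (A n) (ℋ n)) {n₀ : ℕ}
    (hn₀ : A n₀ = ∅) : IsEquivalentNorm (absNorm hp) := by
  refine isEquivalentNorm_supportNorm _ (n₀ := n₀) fun φ => ?_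
  rw [supportFn_absSet (hp n₀), supportFn_absSet (hp n₀), pairGauge_of_eq_empty _ hn₀,
    pairGauge_of_eq_empty _ hn₀, varMeasure_univ, varMeasure_univ]
  linarith [norm_nonneg (-φ)]

theorem isPURAgainst_posNorm (hp : ∀ n, IsLegitimatePair (A n) (ℋ n)) {n₀ : ℕ} (hn₀ : A n₀ = ∅)
    (hcompl : ∀ n, ∃ m, A m = Set.univ ∧ ℋ m = {(A n)ᶜ}) :
    IsPURAgainst (posNorm hp) (indicatorSpan (⋃ n, ℋ n)) := by
  obtain ⟨c, C, hc, hcC⟩ := isEquivalentNorm_posNorm hp hn₀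
  have hnorm : ∀ φ : Dual C(K, ℝ), posNorm hp φ = 1 → ‖φ‖ ≤ c⁻¹ := fun φ hφ => by
    rw [← one_div, le_div_iff₀ hc, mul_comm, ← hφ]
    exact (hcC φ).1
  have hmass : ∀ φ : Dual C(K, ℝ), posNorm hp φ = 1 → (posMeasure φ).real Set.univ ≤ c⁻¹ :=
    fun φ hφ => by
      refine le_trans ?_ (hnorm φ hφ)
      rw [← varMeasure_univ, varMeasure_real_apply]
      exact le_add_of_nonneg_right measureReal_nonneg
  have key : ∀ x y : ℕ → Dual C(K, ℝ), (∀ k, posNorm hp (x k) = 1) → (∀ k, posNorm hp (y k) = 1) →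
      Tendsto (fun k => posNorm hp (x k + y k)) atTop (𝓝 2) → ∀ H ∈ ⋃ n, ℋ n,
      Tendsto (fun k => (posMeasure (x k)).real H - (posMeasure (y k)).real H) atTop (𝓝 0) := by
    intro x y hx hy hxy H hH
    have ht := tendsto_supportFn (fun n => isUnitSubset_posSet (hp n)) (r := 1) hx hy
      (by rw [mul_one]; exact hxy)
    refine tendsto_measureReal_of_pairGauge hp hcompl (M := c⁻¹) (fun k => hmass _ (hx k))
      (fun k => hmass _ (hy k)) (s := fun n k => supportFn (posSet (A n) (ℋ n)) (x k + y k))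
      (fun n k => supportFn_posSet_add_le (hp n) _ _) (fun n => ?_) (fun n => ?_) hH
    · simpa only [supportFn_posSet (hp n)] using (ht n).1
    · exact (ht n).2.congr fun k => by
        rw [supportFn_posSet (hp n) (x k), supportFn_posSet (hp n) (y k)]
  intro x y hx hy hxy f hf
  refine tendsto_of_mem_closedSpan (C := c⁻¹ + c⁻¹) (fun k => ?_) ?_ hf
  · exact (norm_sub_le _ _).trans (add_le_add (hnorm _ (hx k)) (hnorm _ (hy k)))
  · rintro ξ ⟨H, hH, hξ⟩
    obtain rfl := isIndicatorFunctional_iff.mp hξ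
    have h1 := key x y hx hy hxy H hH
    -- The positive parts of `-x k` and `-y k` are the negative parts of `x k` and `y k`.
    have h2 := key (fun k => -x k) (fun k => -y k) (fun k => by rw [map_neg_eq_map, hx])
      (fun k => by rw [map_neg_eq_map, hy])
      (hxy.congr fun k => by rw [← neg_add, map_neg_eq_map]) H hH
    have h3 := h1.sub h2
    rw [sub_zero] at h3
    refine h3.congr fun k => ?_
    rw [map_sub, indicatorFunctional_apply, indicatorFunctional_apply]
    ring

omit [MeasurableSpace K] [BorelSpace K] [T2Space K] in
theorem supportFn_absSet_neg_le {A : Set K} {ℋ : Set (Set K)} (hp : IsLegitimatePair A ℋ)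
    (φ : Dual C(K, ℝ)) : supportFn (absSet A ℋ) (-φ) ≤ supportFn (absSet A ℋ) φ := by
  refine (isUnitSubset_absSet hp).supportFn_le fun h hh => ?_
  rw [neg_apply, ← map_neg]
  exact (isUnitSubset_absSet hp).le_supportFn φ (by simpa [absSet] using hh)

-- Membership in `absSet` depends only on `|h|` and is solid, so its support function is controlled
-- by the values of `modulus`.
omit [MeasurableSpace K] [BorelSpace K] [T2Space K] in
theorem isLatticeNorm_absNorm (hp : ∀ n, IsLegitimatePair (A n) (ℋ n)) :
    IsLatticeNorm (absNorm hp) := by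
  intro φ ψ hle
  have key : ∀ n, supportFn (absSet (A n) (ℋ n)) φ ≤ supportFn (absSet (A n) (ℋ n)) ψ := by
    intro n
    refine (isUnitSubset_absSet (hp n)).supportFn_le fun h hh => ?_
    calc φ h ≤ modulus φ |h| := by
          refine le_csSup ⟨‖φ‖ * ‖|h|‖, ?_⟩ ⟨h, fun t => le_rfl, rfl⟩
          rintro _ ⟨g, hg, rfl⟩
          exact apply_le_norm_mul hg
      _ ≤ modulus ψ |h| := hle |h| fun t => abs_nonneg (h t)
      _ ≤ supportFn (absSet (A n) (ℋ n)) ψ := by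
          refine csSup_le ⟨_, 0, fun t => by simp, rfl⟩ ?_
          rintro _ ⟨g, hg, rfl⟩
          exact (isUnitSubset_absSet (hp n)).le_supportFn ψ
            (posSet_of_le hh (abs_nonneg g) hg)
  refine supportNorm_mono _ key fun n => ?_
  have h := supportFn_absSet_neg_le (hp n) (-ψ)
  rw [neg_neg] at h
  exact (supportFn_absSet_neg_le (hp n) φ).trans ((key n).trans h)

/-- Two regular measures that agree on a legitimate system are equal. -/
theorem measure_eq_of_forall_real_eq (hN : IsOneNorming (indicatorSpan (⋃ n, ℋ n)))
    {μ ν : Measure K} [IsFiniteMeasure μ] [IsFiniteMeasure ν] [μ.Regular] [ν.Regular]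
    (h : ∀ H ∈ ⋃ n, ℋ n, μ.real H = ν.real H) : μ = ν := by
  -- The functional of `μ - ν` is annihilated by the 1-norming span, hence zero.
  let D : Dual C(K, ℝ) := LinearMap.mkContinuous
    (IsLinearMap.mk' (fun f : C(K, ℝ) => (∫ t, f t ∂μ) - ∫ t, f t ∂ν)
      { map_add := fun f g => by
          simp only [ContinuousMap.add_apply]
          rw [integral_add (integrable_continuousMap _ _) (integrable_continuousMap _ _),
            integral_add (integrable_continuousMap _ _) (integrable_continuousMap _ _)]
          ring
        map_smul := fun a f => by
          simp only [ContinuousMap.smul_apply]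
          rw [integral_smul, integral_smul, smul_sub] })
    (μ.real Set.univ + ν.real Set.univ) fun f => by
      have key : ∀ (m : Measure K) [IsFiniteMeasure m],
          ‖∫ t, f t ∂m‖ ≤ m.real Set.univ * ‖f‖ := fun m _ => by
        rw [mul_comm]
        exact norm_integral_le_of_norm_le_const (ae_of_all _ fun t => f.norm_coe_le_norm t)
      rw [add_mul]
      exact (norm_sub_le _ _).trans (add_le_add (key μ) (key ν))
  have hD : IsRepresentedBy D μ ν := fun f => rfl
  have hzero : ∀ ξ ∈ indicatorSpan (⋃ n, ℋ n), ξ D = 0 := by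
    intro ξ hξ
    have : Tendsto (fun _ : ℕ => ξ D) atTop (𝓝 0) := by
      refine tendsto_of_mem_closedSpan (z := fun _ => D) (fun _ => le_rfl) ?_ hξ
      rintro ξ ⟨H, hH, hξ⟩
      rw [hξ D μ ν inferInstance inferInstance inferInstance inferInstance hD, h H hH, sub_self]
      exact tendsto_const_nhds
    exact tendsto_nhds_unique tendsto_const_nhds this
  have hD0 : D = 0 := by
    rw [← norm_le_zero_iff]
    refine (hN D).2 ?_
    rintro _ ⟨ξ, hξ, -, rfl⟩
    exact (hzero ξ hξ).le
  refine measure_ext_of_integral_continuousMap fun f => ?_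
  have := hD f
  rw [hD0, zero_apply] at this
  linarith

/-- A continuous function of modulus at most one that almost norms a functional almost
represents its polar decomposition. -/
theorem apply_sub_integral_mul_le (φ : Dual C(K, ℝ)) (f : C(K, ℝ)) {g : C(K, ℝ)}
    (hg : ∀ t, |g t| ≤ 1) :
    φ f - ∫ t, (f * g) t ∂varMeasure φ ≤ ‖f‖ * (‖φ‖ - φ g) := by
  have hle : ∀ t, |f t| ≤ ‖f‖ := fun t => f.norm_coe_le_norm t
  -- The left side of the goal is `∫ f(1 - g) dφ⁺ - ∫ f(1 + g) dφ⁻`. The weights `1 - g` and `1 + g`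
  -- are nonnegative, and their integrals add up to `‖φ‖ - φ g`.
  have e1 : ∫ t, (f * (1 - g)) t ∂posMeasure φ ≤ ∫ t, (‖f‖ • (1 - g)) t ∂posMeasure φ := by
    refine integral_mono (integrable_continuousMap _ _) (integrable_continuousMap _ _) fun t => ?_
    exact mul_le_mul_of_nonneg_right (abs_le.mp (hle t)).2
      (sub_nonneg.mpr (abs_le.mp (hg t)).2)
  have e2 : ∫ t, (-f * (1 + g)) t ∂posMeasure (-φ) ≤
      ∫ t, (‖f‖ • (1 + g)) t ∂posMeasure (-φ) := by
    refine integral_mono (integrable_continuousMap _ _) (integrable_continuousMap _ _) fun t => ?_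
    have h1 : -f t ≤ ‖f‖ := by linarith [(abs_le.mp (hle t)).1]
    have h2 : 0 ≤ 1 + g t := by linarith [(abs_le.mp (hg t)).1]
    exact mul_le_mul_of_nonneg_right h1 h2
  simp only [ContinuousMap.mul_apply, ContinuousMap.smul_apply, ContinuousMap.sub_apply,
    ContinuousMap.add_apply, ContinuousMap.neg_apply, ContinuousMap.one_apply, smul_eq_mul,
    mul_sub, mul_add, mul_one, neg_mul] at e1 e2
  have hfi := fun (μ : Measure K) [IsFiniteMeasure μ] => integrable_continuousMap f μ
  have hgi := fun (μ : Measure K) [IsFiniteMeasure μ] => integrable_continuousMap g μ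
  have hfg : ∀ (μ : Measure K) [IsFiniteMeasure μ], Integrable (fun t => f t * g t) μ :=
    fun μ _ => integrable_continuousMap (f * g) μ
  have hfn : ∀ (μ : Measure K) [IsFiniteMeasure μ], Integrable (fun t => -f t) μ :=
    fun μ _ => (hfi μ).neg
  have hgc : ∀ (μ : Measure K) [IsFiniteMeasure μ], Integrable (fun t => ‖f‖ * g t) μ :=
    fun μ _ => (hgi μ).const_mul _
  have hfgn : ∀ (μ : Measure K) [IsFiniteMeasure μ], Integrable (fun t => -(f t * g t)) μ :=
    fun μ _ => (hfg μ).neg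
  rw [integral_sub (hfi _) (hfg _), integral_sub (integrable_const _) (hgc _),
    integral_const_mul, integral_const, smul_eq_mul] at e1
  rw [integral_add (hfn _) (hfgn _), integral_add (integrable_const _) (hgc _),
    integral_const_mul, integral_const, smul_eq_mul, integral_neg, integral_neg] at e2
  rw [integral_varMeasure, isRepresentedBy_posMeasure φ f, isRepresentedBy_posMeasure φ g,
    ← varMeasure_univ, varMeasure_real_apply]
  simp only [ContinuousMap.mul_apply]
  linarith

/-- In the dual of `C(K)`, equality of variations and additivity of the norm force equality. -/
theorem eq_of_varMeasure_eq {φ ψ : Dual C(K, ℝ)} (h : varMeasure φ = varMeasure ψ)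
    (hadd : ‖φ + ψ‖ = ‖φ‖ + ‖ψ‖) : φ = ψ := by
  have key : ∀ f : C(K, ℝ), φ f - ψ f ≤ 0 := by
    intro f
    have hε : ∀ ε : ℝ, 0 < ε → φ f - ψ f ≤ 0 + ε := by
      intro ε hε
      set δ := ε / (2 * (‖f‖ + 1)) with hδ
      have hδ0 : 0 < δ := by positivity
      have h1 : ∫ t, (1 : C(K, ℝ)) t ∂varMeasure (φ + ψ) = ‖φ + ψ‖ := by
        rw [← varMeasure_univ]; simp
      -- By norm additivity one `g` nearly norms both functionals, so both are close to `g` times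
      -- their common variation.
      obtain ⟨g, hg, hgl⟩ := exists_lt_of_lt_integral_varMeasure (φ + ψ) (f := 1) zero_le_one
        (r := ‖φ + ψ‖ - δ) (by rw [h1]; linarith)
      have hg1 : ∀ t, |g t| ≤ 1 := hg
      have hng : ‖g‖ ≤ 1 := (ContinuousMap.norm_le _ zero_le_one).mpr hg1
      have hφg : φ g ≤ ‖φ‖ := (le_abs_self _).trans ((φ.le_opNorm g).trans
        (mul_le_of_le_one_right (norm_nonneg _) hng))
      have hψg : ψ g ≤ ‖ψ‖ := (le_abs_self _).trans ((ψ.le_opNorm g).trans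
        (mul_le_of_le_one_right (norm_nonneg _) hng))
      rw [add_apply, hadd] at hgl
      have e1 := apply_sub_integral_mul_le φ f hg1
      have e2 := apply_sub_integral_mul_le ψ (-f) hg1
      rw [map_neg, norm_neg] at e2
      simp only [ContinuousMap.mul_apply, ContinuousMap.neg_apply, neg_mul, integral_neg] at e1 e2
      rw [h] at e1
      have e3 : ‖f‖ * (‖φ‖ - φ g) ≤ ‖f‖ * δ :=
        mul_le_mul_of_nonneg_left (by linarith) (norm_nonneg _)
      have e4 : ‖f‖ * (‖ψ‖ - ψ g) ≤ ‖f‖ * δ :=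
        mul_le_mul_of_nonneg_left (by linarith) (norm_nonneg _)
      have e5 : 2 * (‖f‖ * δ) ≤ ε := by
        rw [hδ, mul_div_assoc', mul_div_assoc', div_le_iff₀ (by positivity)]
        nlinarith [norm_nonneg f]
      linarith
    exact le_of_forall_pos_le_add hε
  ext f
  have h1 := key f
  have h2 := key (-f)
  rw [map_neg, map_neg] at h2
  linarith

theorem isStrictlyConvexNorm_absNorm (hp : ∀ n, IsLegitimatePair (A n) (ℋ n)) {n₀ : ℕ}
    (hn₀ : A n₀ = ∅) (hcompl : ∀ n, ∃ m, A m = Set.univ ∧ ℋ m = {(A n)ᶜ})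
    (hN : IsOneNorming (indicatorSpan (⋃ n, ℋ n))) : IsStrictlyConvexNorm (absNorm hp) := by
  intro x y hxy hsum
  -- On constant sequences the asymptotic statements become exact equalities.
  have ht := tendsto_supportFn (fun n => isUnitSubset_absSet (hp n)) (x := fun _ => x)
    (y := fun _ => y) (r := absNorm hp y) (fun _ => hxy) (fun _ => rfl)
    (tendsto_const_nhds.congr fun _ => by
      change 2 * absNorm hp y = absNorm hp (x + y)
      linarith)
  have hvar : varMeasure x = varMeasure y := by
    refine measure_eq_of_forall_real_eq hN fun H hH => sub_eq_zero.mp ?_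
    refine tendsto_nhds_unique tendsto_const_nhds (tendsto_measureReal_of_pairGauge hp hcompl
      (μ := fun _ => varMeasure x) (ν := fun _ => varMeasure y)
      (M := max ‖x‖ ‖y‖) (fun _ => (varMeasure_univ x).le.trans (le_max_left _ _))
      (fun _ => (varMeasure_univ y).le.trans (le_max_right _ _))
      (s := fun n _ => supportFn (absSet (A n) (ℋ n)) (x + y))
      (fun n _ => supportFn_absSet_add_le (hp n) _ _) (fun n => ?_) (fun n => ?_) hH)
    · simpa only [supportFn_absSet (hp n)] using (ht n).1
    · simpa only [supportFn_absSet (hp n)] using (ht n).2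
  refine eq_of_varMeasure_eq hvar ?_
  have h := tendsto_nhds_unique tendsto_const_nhds (ht n₀).2
  rw [supportFn_absSet (hp n₀), supportFn_absSet (hp n₀), supportFn_absSet (hp n₀),
    pairGauge_of_eq_empty _ hn₀, pairGauge_of_eq_empty _ hn₀, pairGauge_of_eq_empty _ hn₀,
    varMeasure_univ, varMeasure_univ, varMeasure_univ] at h
  linarith

theorem IsOneNorming.isSeparatingSubspace {E : Type*} [NormedAddCommGroup E] [NormedSpace ℝ E]
    {F : Submodule ℝ (Dual E)} (hF : IsOneNorming F) : IsSeparatingSubspace F := by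
  intro x y hxy
  by_contra! h
  refine hxy (sub_eq_zero.mp (norm_le_zero_iff.mp ((hF (x - y)).2 ?_)))
  rintro _ ⟨f, hf, -, rfl⟩
  rw [map_sub, h f hf, sub_self]

end Renorming

end GruenhageRenorming

open GruenhageRenorming in
theorem theorem2p6 {K : Type*} [TopologicalSpace K] [CompactSpace K] [T2Space K]
    [MeasurableSpace K] [BorelSpace K] (hK : IsGruenhage K) :
    (∃ p : Seminorm ℝ (Dual C(K, ℝ)),
      IsEquivalentNorm p ∧ IsStrictlyConvexNorm p ∧ IsDualNorm p ∧ IsLatticeNorm p) ∧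
    (∃ p : Seminorm ℝ (Dual C(K, ℝ)),
      IsEquivalentNorm p ∧ IsDualNorm p ∧ IsPUR p ∧
      ∃ (A : ℕ → Set K) (ℋ : ℕ → Set (Set K)), IsLegitimateSystem A ℋ ∧
        IsOneNorming (indicatorSpan (⋃ n, ℋ n)) ∧
        IsPURAgainst p (indicatorSpan (⋃ n, ℋ n))) := by
  obtain ⟨A, ℋ, hsys, hp, hcompl, n₀, hn₀⟩ := hK.exists_isLegitimateSystem
  have hN := isOneNorming_indicatorSpan hsys hp hn₀
  have habs := isEquivalentNorm_absNorm hp hn₀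
  have hpos := isEquivalentNorm_posNorm hp hn₀
  have hpur := isPURAgainst_posNorm hp hn₀ hcompl
  exact ⟨⟨absNorm hp, habs, isStrictlyConvexNorm_absNorm hp hn₀ hcompl hN,
      isDualNorm_supportNorm _ habs, isLatticeNorm_absNorm hp⟩,
    posNorm hp, hpos, isDualNorm_supportNorm _ hpos, ⟨_, hN.isSeparatingSubspace, hpur⟩,
    A, ℋ, hsys, hN, hpur⟩
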